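/- Let $G=(V,E)$ be a tree with a finite vertex set $V$, $|V|\ge 2$. For each $v\in V$ let $\mathcal I_v$ be a finite set, and put $\mathcal I=\prod_{v\in V}\mathcal I_v$ and $\mathcal I_D=\prod_{v\in D}\mathcal I_v$ for $D\subset V$; write $\underline i_D$ for the restriction of $\underline i\in\mathcal I$ to $D$. For a table $q$ on $\mathcal I$ let $q^D_{\underline k}=\sum_{\underline i:\,\underline i_D=\underline k}q(\underline i)$ be its $D$-marginal. Let $C_1,\dots,C_K$ be the cliques (maximal complete subsets) of $G$ in a perfect order, that is, with $S_1=\emptyset$ and $S_j=C_j\cap(C_1\cup\dots\cup C_{j-1})$, for every $j>1$ there is $i<j$ with $S_j\subset C_i$. Let ${\bf p}=({\bf p}(\underline i),\,\underline i\in\mathcal I)$ be a random vector, almost surely with positive entries that sum to $1$, which is associated with $G$: almost surely, for all $\underline i\in\mathcal I$, $${\bf p}(\underline i)=\frac{\prod_{l=1}^K{\bf p}^{C_l}_{\underline i_{C_l}}}{\prod_{l=2}^K{\bf p}^{S_l}_{\underline i_{S_l}}}.$$ Write $\mathbb P_{\bf p}$ for probabilities computed for a random vector ${\bf X}=(X_v)_{v\in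 V}$ with $\mathbb P_{\bf p}({\bf X}=\underline i)={\bf p}(\underline i)$. For $v\in V$ let $\mathcal G_v$ be the directed acyclic graph obtained from $G$ by directing all edges away from $v$, and let $\mathfrak p_w$ be the set of parents of $w$ in it (it is empty for $w=v$ and has exactly one element otherwise). Parameter independence with respect to $\mathcal G_v$ means that the random vectors $$\big(\mathbb P_{\bf p}(X_w=l\mid {\bf X}_{\mathfrak p_w}=\underline k),\ l\in\mathcal I_w\big),\qquad \underline k\in\mathcal I_{\mathfrak p_w},\ w\in V,$$ are mutually independent and that each of them is non-degenerate (not almost surely constant). Assume that for every leaf $v$ of $G$ (vertex of degree one) parameter independence with respect to $\mathcal G_v$ holds. Then ${\bf p}$ follows a hyper Dirichlet distribution with respect to $G$: there are numbers $\alpha^{C_l}_{\underline k}>0$ ($\underline k\in\mathcal I_{C_l}$) and $\alpha^{S_l}_{\underline n}$ ($\underline n\in\mathcal I_{S_l}$), $l=1,\dots,K$, with $$\sum_{\underline k\in\mathcal I_{C_m}:\,\underline k_{S_l}=\underline n}\alpha^{C_m}_{\underline k}=\alpha^{S_l}_{\underline n}\qquad\text{whenever } S_l\subset C_m,\ \underline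 n\in\mathcal I_{S_l}$$ (for $S_1=\emptyset$ this says that each $\alpha^{C_m}$ has the same total $\alpha=\alpha^{\emptyset}$), such that for all tables $\underline r=(r(\underline i),\,\underline i\in\mathcal I)$ of non-negative integers $$\mathbb E\prod_{\underline i\in\mathcal I}{\bf p}(\underline i)^{r(\underline i)}=\frac{\mathcal Z(\alpha+r)}{\mathcal Z(\alpha)},\qquad \mathcal Z(\alpha)=\frac{\prod_{l=1}^K\prod_{\underline k\in\mathcal I_{C_l}}\Gamma(\alpha^{C_l}_{\underline k})}{\Gamma(\alpha)\prod_{l=2}^K\prod_{\underline n\in\mathcal I_{S_l}}\Gamma(\alpha^{S_l}_{\underline n})},$$ where $\alpha+r$ is obtained by adding to each $\alpha^D_{\underline k}$ the marginal count $r^D_{\underline k}$. (As ${\bf p}$ takes values in the simplex, these moments determine its distribution.) -/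

import Mathlib

open MeasureTheory ProbabilityTheory

namespace GraphDirichlet

variable {V : Type*} [Fintype V] [DecidableEq V]
variable {I : V → Type*} [∀ v, Fintype (I v)] [∀ v, DecidableEq (I v)]

/-- The `D`-marginal of a table `q` on the cells `∏ v, I v`: the sum of `q i` over all the cells `i`
with `i_D = k`. It is used for probability tables (real entries) and for count tables. -/
def marginal {M : Type*} [AddCommMonoid M] (q : (∀ v, I v) → M) (D : Finset V)
    (k : ∀ u : D, I u) : M :=
  ∑ i with D.restrict i = k, q i

/-- The conditional probability `ℙ(X_v = l | X_D = k)` when `X` has the probability table `q`. -/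
noncomputable def condProb (q : (∀ v, I v) → ℝ) (v : V) (D : Finset V) (k : ∀ u : D, I u)
    (l : I v) : ℝ :=
  (∑ i with D.restrict i = k ∧ i v = l, q i) / marginal q D k

/-- The separator `S_j = C_j ∩ (⋃_{i < j} C_i)`; the first one is empty. -/
def separator {K : ℕ} (C : Fin K → Finset V) (j : Fin K) : Finset V :=
  C j ∩ (Finset.Iio j).biUnion C

/-- `C` lists the cliques (the maximal complete subsets) of `G`, each of them once,
in a perfect order. -/
structure IsPerfectOrder (G : SimpleGraph V) {K : ℕ} (C : Fin K → Finset V) : Prop where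
  injective : Function.Injective C
  mem_range_iff : ∀ D : Finset V,
    D ∈ Set.range C ↔ Maximal (fun s : Finset V => G.IsClique (s : Set V)) D
  perfect : ∀ j : Fin K, 0 < (j : ℕ) → ∃ i < j, separator C j ⊆ C i

variable {Ω : Type*} [MeasurableSpace Ω]

/-- `p` is a vector of random cell probabilities: almost surely its entries are positive
and sum to one. -/
structure IsRandomProbabilities (μ : Measure Ω) (p : Ω → (∀ v, I v) → ℝ) : Prop where
  measurable : Measurable p
  pos : ∀ᵐ ω ∂μ, ∀ i, 0 < p ω i
  sum_eq_one : ∀ᵐ ω ∂μ, ∑ i, p ω i = 1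

/-- `p` is a vector of random cell probabilities associated with `G`: it factorizes over the cliques
and the separators of `G`, the separators being counted with their multiplicity in a perfect order.
The factor of the first separator, which is empty, is `∑ i, p ω i = 1`. -/
def IsAssociated (G : SimpleGraph V) (μ : Measure Ω) (p : Ω → (∀ v, I v) → ℝ) : Prop :=
  IsRandomProbabilities μ p ∧
    ∃ (K : ℕ) (C : Fin K → Finset V), IsPerfectOrder G C ∧
      ∀ᵐ ω ∂μ, ∀ i : ∀ v, I v,
        p ω i = (∏ l, marginal (p ω) (C l) ((C l).restrict i)) /
          ∏ l, marginal (p ω) (separator C l) ((separator C l).restrict i)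

/-- Parameter independence (local and global) for `p` with respect to the directed acyclic graph
with parent function `𝔭`: the random vectors `(ℙ_p(X_v = l | X_{𝔭 v} = k), l ∈ I v)`, for `v : V` and
`k` a cell of `𝔭 v`, are mutually independent, and none of them is almost surely constant. -/
def ParameterIndependence (μ : Measure Ω) (p : Ω → (∀ v, I v) → ℝ) (𝔭 : V → Finset V) : Prop :=
  iIndepFun (fun (x : Σ v : V, (∀ u : 𝔭 v, I u)) (ω : Ω) (l : I x.1) =>
      condProb (p ω) x.1 (𝔭 x.1) x.2 l) μ ∧
    ∀ (v : V) (k : ∀ u : 𝔭 v, I u),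
      ¬ ∃ c : I v → ℝ, ∀ᵐ ω ∂μ, (fun l => condProb (p ω) v (𝔭 v) k l) = c

/-- The parent function of the directed acyclic graph obtained from a tree `G` by choosing the
root `r` and directing every edge away from `r`. -/
noncomputable def rootedParents (G : SimpleGraph V) [DecidableRel G.Adj] (r w : V) : Finset V :=
  {u | G.Adj u w ∧ G.dist r w = G.dist r u + 1}

/-- The normalizing constant of the hyper Dirichlet distribution. The factor `Γ(α)` of the total mass
is the one of the first separator, which is empty. -/
noncomputable def normConst {K : ℕ} (C : Fin K → Finset V)
    (α : ∀ D : Finset V, (∀ u : D, I u) → ℝ) : ℝ :=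
  (∏ l, ∏ k, Real.Gamma (α (C l) k)) / ∏ l, ∏ k, Real.Gamma (α (separator C l) k)

/-- `α` is a system of hyperparameters: positive on the clique cells, and consistent, in that
`α^S` is the `S`-marginal of `α^C` whenever the separator `S` (possibly empty) is contained in the
clique `C`. Only the values of `α` at cliques and separators matter. -/
structure IsHyperparameter {K : ℕ} (C : Fin K → Finset V)
    (α : ∀ D : Finset V, (∀ u : D, I u) → ℝ) : Prop where
  pos : ∀ l k, 0 < α (C l) k
  consistent : ∀ (l m : Fin K) (h : separator C l ⊆ C m) (s : ∀ u : separator C l, I u),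
    ∑ k with Finset.restrict₂ h k = s, α (C m) k = α (separator C l) s

/-- `p` is associated with `G` and follows a hyper Dirichlet distribution with respect to `G`.
As `p` takes its values in the simplex, its law is determined by its moments, and the
hyper Dirichlet distribution is given by its moments
`𝔼 ∏ i, p(i) ^ r(i) = Z(α + r) / Z(α)`, where `Z` is the normalizing constant and `α + r` stands for
the addition of the clique and separator marginals of `r`. -/
def FollowsHyperDirichlet (G : SimpleGraph V) (μ : Measure Ω) (p : Ω → (∀ v, I v) → ℝ) : Prop :=
  IsAssociated G μ p ∧
    ∃ (K : ℕ) (C : Fin K → Finset V), IsPerfectOrder G C ∧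
      ∃ α : ∀ D : Finset V, (∀ u : D, I u) → ℝ, IsHyperparameter C α ∧
        ∀ r : (∀ v, I v) → ℕ,
          ∫ ω, ∏ i, p ω i ^ r i ∂μ =
            normConst C (fun D k => α D k + ((marginal r D k : ℕ) : ℝ)) / normConst C α

end GraphDirichlet

set_option linter.unusedSectionVars false

/-! Rooting the tree at a leaf can direct any given edge either way: among the vertices on the side
of `u`, one farthest from `w` is a leaf, and from there the edge points from `u` to `w`
(`exists_leaf_rootedParents_eq`). Under that root the marginal at `u` is almost surely a function of
parameters at vertices closer to the root than `w`, so it is independent of the conditional rows at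
`w`, which are independent of each other. The moments of the edge table therefore factor by rows,
and with the opposite root by columns (`isRowFactorization`).

These two factorizations make the edge table Dirichlet. The argument uses moments only, with no
density. Let `M` be the moment function and consider the prediction rule `M (r + units a 1) / M r`.
Units can be moved freely among the cells other than `a`, by rows and by columns, so the rule
depends only on `r a` and on the total of `r` (`step_eq_step`). As in Johnson's sufficientness
argument, it must then be affine in `r a`: it is the Pólya urn rule `(M (units a 1) + κ * r a) / (1
+ κ * ∑ t, r t)` (`exists_affine`). Non-degeneracy excludes `κ = 0`, and `1 / κ` is the total mass.

Each vertex marginal determines `κ`, so all the edges of the connected tree share it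
(`VertexRecursion.unique`, `exists_recursion`). The hyperparameters are the expected marginals
divided by `κ`, and consistency is additivity of marginals. Finally, under one root the cell
probabilities are products of independent conditional probabilities with Dirichlet moments. The
resulting Gamma quotients over vertices and parent sets are regrouped over cliques and separators by
counting multiplicities (`prod_div_prod_separator`). -/

namespace GraphDirichlet

/-! ### Tables of counts and the Dirichlet moment recursion -/

section Tables

variable {T : Type*} [DecidableEq T]

/-- The table with `n` units in the cell `a`. -/
abbrev units (a : T) (n : ℕ) : T → ℕ := Pi.single a n

theorem units_add (a : T) (m n : ℕ) : units a (m + n) = units a m + units a n :=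
  Pi.single_add (f := fun _ : T => ℕ) a m n

variable [Fintype T]

theorem sum_add_units (r : T → ℕ) (a : T) (n : ℕ) :
    ∑ t, (r + units a n) t = ∑ t, r t + n := by
  simp [Finset.sum_add_distrib]

/-- A function of tables that does not see where the units outside `t₀` are placed depends only on
the entry at `t₀` and on the total. -/
theorem eq_of_apply_eq_of_sum_eq {β : Type*} (Q : (T → ℕ) → β) {t₀ t₁ : T}
    (hQ : ∀ r a, a ≠ t₀ → Q (r + units a 1) = Q (r + units t₁ 1)) {r r' : T → ℕ}
    (h₀ : r t₀ = r' t₀) (hs : ∑ t, r t = ∑ t, r' t) : Q r = Q r' := by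
  have h1 : ∀ a, a ≠ t₀ → ∀ n r, Q (r + units a n) = Q (r + units t₁ n) := by
    intro a ha n
    induction n with
    | zero => simp
    | succ n ih =>
      intro r
      rw [units_add, ← add_assoc, hQ _ _ ha, add_right_comm, ih, add_right_comm, add_assoc,
        ← units_add]
  have h2 : ∀ (S : Finset T) (n : T → ℕ), t₀ ∉ S → ∀ r,
      Q (r + ∑ a ∈ S, units a (n a)) = Q (r + units t₁ (∑ a ∈ S, n a)) := by
    intro S n
    induction S using Finset.induction_on with
    | empty => simp
    | insert a S ha ih =>
      intro hS r
      rw [Finset.mem_insert, not_or] at hS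
      rw [Finset.sum_insert ha, Finset.sum_insert ha, ← add_assoc, ih hS.2, add_right_comm,
        h1 a (Ne.symm hS.1), add_assoc,
        ← units_add, add_comm (n a)]
  -- Normal form: every unit outside `t₀` is moved to `t₁`. Only the entry at `t₀` and the total
  -- survive.
  have h3 : ∀ r : T → ℕ, Q r = Q (units t₀ (r t₀) + units t₁ (∑ t, r t - r t₀)) := by
    intro r
    have e1 : r = units t₀ (r t₀) + ∑ a ∈ Finset.univ.erase t₀, units a (r a) := by
      rw [Finset.add_sum_erase _ (fun a => units a (r a)) (Finset.mem_univ t₀)]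
      exact (Finset.univ_sum_single r).symm
    have e2 : ∑ t, r t - r t₀ = ∑ a ∈ Finset.univ.erase t₀, r a := by
      rw [← Finset.add_sum_erase _ r (Finset.mem_univ t₀)]
      simp
    rw [e2, ← h2 _ _ (by simp), ← e1]
  rw [h3 r, h3 r', h₀, hs]

/-- The Gamma form of a function of tables that satisfies the recursion of Dirichlet moments. -/
theorem eq_gamma_of_recursion (f : (T → ℕ) → ℝ) (α : T → ℝ) {β : ℝ} (hα : ∀ t, 0 < α t)
    (hβ : 0 < β) (h0 : f 0 = 1)
    (hf : ∀ n t, f (n + units t 1) * (β + ∑ s, (n s : ℝ)) = f n * (α t + n t)) (n : T → ℕ) :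
    f n = (∏ t, Real.Gamma (α t + n t) / Real.Gamma (α t)) /
      (Real.Gamma (β + ∑ t, (n t : ℝ)) / Real.Gamma β) := by
  have key : ∀ N : ℕ, ∀ n : T → ℕ, ∑ t, n t = N →
      f n = (∏ t, Real.Gamma (α t + n t) / Real.Gamma (α t)) /
        (Real.Gamma (β + ∑ t, (n t : ℝ)) / Real.Gamma β) := by
    intro N
    induction N with
    | zero =>
      intro n hn
      have : n = 0 := by
        ext t
        simpa using (Finset.sum_eq_zero_iff.1 hn) t
      subst this
      have h1 := (Real.Gamma_pos_of_pos hβ).ne'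
      have h2 := fun t => (Real.Gamma_pos_of_pos (hα t)).ne'
      simp [h0, h1, h2]
    | succ N ih =>
      intro n hn
      obtain ⟨t, ht⟩ : ∃ t, n t ≠ 0 := by
        by_contra! h
        simp [h] at hn
      obtain ⟨m, rfl⟩ : ∃ m : T → ℕ, n = m + units t 1 := by
        refine ⟨n - units t 1, ?_⟩
        ext s
        rcases eq_or_ne s t with rfl | h
        · simp
          omega
        · simp [h]
      have hm : ∑ s, m s = N := by
        rw [sum_add_units] at hn
        omega
      have hpos : 0 < β + ∑ s, (m s : ℝ) := by positivity
      have h1 : f (m + units t 1) = f m * ((α t + m t) / (β + ∑ s, (m s : ℝ))) := by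
        rw [← mul_div_assoc, ← hf, mul_div_cancel_right₀ _ hpos.ne']
      have h2 : ∏ s, Real.Gamma (α s + (m + units t 1) s) / Real.Gamma (α s) =
          (α t + m t) * ∏ s, Real.Gamma (α s + m s) / Real.Gamma (α s) := by
        rw [← Finset.mul_prod_erase _ _ (Finset.mem_univ t),
          ← Finset.mul_prod_erase _ (fun s => Real.Gamma (α s + m s) / Real.Gamma (α s))
            (Finset.mem_univ t), ← mul_assoc]
        congr 1
        · have : α t + m t ≠ 0 := by have := hα t; positivity
          simp only [Pi.add_apply, Pi.single_eq_same, Nat.cast_add, Nat.cast_one]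
          rw [← add_assoc, Real.Gamma_add_one this, mul_div_assoc]
        · refine Finset.prod_congr rfl fun s hs => ?_
          simp [Finset.ne_of_mem_erase hs]
      have h3 : β + ∑ s, ((m + units t 1) s : ℝ) = β + ∑ s, (m s : ℝ) + 1 := by
        have := sum_add_units m t 1
        rw [add_assoc]
        congr 1
        exact_mod_cast this
      have h4 := (Real.Gamma_pos_of_pos hpos).ne'
      rw [h1, ih m hm, h2, h3, Real.Gamma_add_one hpos.ne']
      field_simp
  exact key _ n rfl

end Tables

/-! ### From a sufficientness condition to the Pólya urn rule -/

section Core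

variable {T : Type*} [Fintype T] [DecidableEq T]

theorem sum_units_add_units_add_units {a b c : T} {x y N : ℕ} (h : x + y ≤ N) :
    ∑ t, (units a x + units b y + units c (N - x - y)) t = N := by
  simp [Finset.sum_add_distrib]
  omega

/-- If the conditional expectations `Q a r` depend only on `r a` and on the total, if along each pair
of aligned cells a transfer of one unit preserves their sum and their ratio does not depend on the total,
then they are the ones of the Dirichlet distribution. -/
theorem exists_affine_of_aligned (Q : T → (T → ℕ) → ℝ) (adj : T → T → Prop)
    (hpos : ∀ a r, 0 < Q a r) (hsum : ∀ r, ∑ a, Q a r = 1)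
    (hloc : ∀ a r r', r a = r' a → ∑ t, r t = ∑ t, r' t → Q a r = Q a r')
    (hconn : ∀ f : T → ℝ, (∀ a b, adj a b → f a = f b) → ∀ a b, f a = f b)
    (hadj : ∀ a, ∃ b, adj a b) (hne : ∀ a b, adj a b → a ≠ b)
    (hthird : ∀ a b : T, ∃ c, c ≠ a ∧ c ≠ b)
    (htransfer : ∀ a b, adj a b → ∀ s, Q a (s + units a 1) + Q b (s + units a 1) =
      Q a (s + units b 1) + Q b (s + units b 1))
    (hratio : ∀ a b, adj a b → ∀ r r', r a = r' a → r b = r' b →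
      Q a r * Q b r' = Q b r * Q a r') :
    ∃ κ : ℝ, 0 ≤ κ ∧ ∀ a r, Q a r * (1 + κ * ∑ t, (r t : ℝ)) = Q a 0 + κ * r a := by
  choose o ho _ using fun a => hthird a a
  -- `q a x N` is the value of `Q a` at entry `x` and total `N`; the auxiliary cell `o a ≠ a`
  -- absorbs the other `N - x` units. It has this meaning only for `x ≤ N`.
  set q : T → ℕ → ℕ → ℝ := fun a x N => Q a (units a x + units (o a) (N - x)) with hq
  have hqQ : ∀ a r, Q a r = q a (r a) (∑ t, r t) := by
    intro a r
    have hle : r a ≤ ∑ t, r t := Finset.single_le_sum (fun _ _ => Nat.zero_le _) (Finset.mem_univ a)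
    refine hloc a _ _ ?_ ?_
    · simp [(ho a).symm]
    · have := sum_units_add_units_add_units (a := a) (b := a) (c := o a) (x := r a) (y := 0) hle
      simpa using this.symm
  have hq0 : ∀ a, q a 0 0 = Q a 0 := fun a => by simp [hq]
  have hq_pos : ∀ a x N, 0 < q a x N := fun a x N => hpos _ _
  -- evaluation on a table with prescribed entries at two cells
  have hev : ∀ a b, adj a b → ∀ x y N, x + y ≤ N → ∃ r : T → ℕ, r a = x ∧ r b = y ∧ ∑ t, r t = N := by
    intro a b hab x y N h
    obtain ⟨c, hca, hcb⟩ := hthird a b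
    exact ⟨units a x + units b y + units c (N - x - y), by simp [hne a b hab, hca.symm],
      by simp [(hne a b hab).symm, hcb.symm], sum_units_add_units_add_units h⟩
  have htr : ∀ a b, adj a b → ∀ x y N, x + y + 1 ≤ N →
      q a (x + 1) N - q a x N = q b (y + 1) N - q b y N := by
    intro a b hab x y N h
    obtain ⟨s, hsa, hsb, hs⟩ := hev a b hab x y (N - 1) (by omega)
    have h1 := htransfer a b hab s
    have hN : N - 1 + 1 = N := by omega
    simp only [hqQ, sum_add_units, hs, hN] at h1
    simp [hsa, hsb, hne a b hab, (hne a b hab).symm] at h1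
    linarith
  have hrat : ∀ a b, adj a b → ∀ x y N N', x + y ≤ N → x + y ≤ N' →
      q a x N * q b y N' = q b y N * q a x N' := by
    intro a b hab x y N N' h h'
    obtain ⟨r, hra, hrb, hr⟩ := hev a b hab x y N h
    obtain ⟨s, hsa, hsb, hs⟩ := hev a b hab x y N' h'
    have := hratio a b hab r s (by omega) (by omega)
    simpa only [hqQ, hr, hs, hra, hrb, hsa, hsb] using this
  have hT : Nonempty T := by
    by_contra h
    rw [not_nonempty_iff] at h
    simpa using hsum 0
  obtain ⟨a₀⟩ := hT
  -- `c` will be the slope in the entry and `d` the factor of the constant term. The truncated value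
  -- `c 0` is harmless: in `hlin` it only occurs multiplied by `x = 0`.
  set c : ℕ → ℝ := fun N => q a₀ 1 N - q a₀ 0 N with hc
  set d : ℕ → ℝ := fun N => q a₀ 0 N / q a₀ 0 0 with hd
  have hcN : ∀ N, 1 ≤ N → ∀ a, q a 1 N - q a 0 N = c N := by
    intro N hN a
    exact hconn (fun a => q a 1 N - q a 0 N) (fun a b hab => htr a b hab 0 0 N (by omega)) a a₀
  -- The increment at `a` from `x` equals the increment at an aligned cell from `0`, whatever `x`
  -- is; hence affinity.
  have hstep : ∀ a x N, x + 1 ≤ N → q a (x + 1) N - q a x N = c N := by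
    intro a x N h
    obtain ⟨b, hab⟩ := hadj a
    rw [htr a b hab x 0 N (by omega)]
    exact hcN N (by omega) b
  have hdN : ∀ N a, q a 0 N = d N * q a 0 0 := by
    intro N a
    have := hconn (fun a => q a 0 N / q a 0 0) (fun a b hab => by
      have := hrat a b hab 0 0 N 0 (by simp) (by simp)
      rw [div_eq_div_iff (hq_pos _ _ _).ne' (hq_pos _ _ _).ne']
      linarith) a a₀
    exact (div_eq_iff (hq_pos _ _ _).ne').1 this
  have hlin : ∀ a N x, x ≤ N → q a x N = d N * Q a 0 + x * c N := by
    intro a N x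
    induction x with
    | zero => intro _; rw [hdN, hq0]; simp
    | succ x ih =>
      intro h
      have h1 := hstep a x N h
      have h2 := ih (by omega)
      push_cast
      linarith
  have hd_pos : ∀ N, 0 < d N := fun N => div_pos (hq_pos _ _ _) (hq_pos _ _ _)
  -- Comparing the ratios at entries `1` and `0` for the totals `N` and `1` shows that `c N / d N`
  -- does not depend on `N`.
  have hcd : ∀ N, 1 ≤ N → c N * d 1 = c 1 * d N := by
    intro N hN
    obtain ⟨b, hab⟩ := hadj a₀
    have h1 := hrat a₀ b hab 1 0 N 1 (by omega) (by omega)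
    rw [hlin _ _ _ hN, hlin _ _ _ (by omega : 0 ≤ 1), hlin _ _ _ (by omega : 0 ≤ N),
      hlin _ _ _ le_rfl] at h1
    have h2 := hpos b 0
    refine mul_right_cancel₀ h2.ne' ?_
    push_cast at h1
    linarith
  set κ := c 1 / d 1 with hκ
  have hQ : ∀ a r, Q a r = d (∑ t, r t) * (Q a 0 + κ * r a) := by
    intro a r
    have hle : r a ≤ ∑ t, r t := Finset.single_le_sum (fun _ _ => Nat.zero_le _) (Finset.mem_univ a)
    rw [hqQ, hlin _ _ _ hle]
    rcases Nat.eq_zero_or_pos (∑ t, r t) with h0 | h0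
    · have : r a = 0 := by omega
      simp [this]
    · have h1 := hcd _ h0
      have h2 := (hd_pos 1).ne'
      rw [hκ]
      field_simp
      linear_combination (r a : ℝ) * h1
  -- Summing the affine form over all cells identifies `d`, because the values `Q a r` sum to one.
  have hdsum : ∀ r : T → ℕ, d (∑ t, r t) * (1 + κ * ∑ t, (r t : ℝ)) = 1 := by
    intro r
    have h1 := hsum r
    rwa [Finset.sum_congr rfl fun a _ => hQ a r, ← Finset.mul_sum,
      Finset.sum_add_distrib, hsum, ← Finset.mul_sum] at h1
  refine ⟨κ, ?_, fun a r => ?_⟩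
  -- A negative `κ` would make `1 + κ * N` negative for a large total `N`, against `d N > 0`.
  · by_contra! hneg
    obtain ⟨N, hN⟩ := exists_nat_gt (1 / -κ)
    rw [div_lt_iff₀ (by linarith)] at hN
    have h1 := hdsum (units a₀ N)
    have h2 := hd_pos (∑ t, units a₀ N t)
    have h3 : ∑ t, ((units a₀ N t : ℕ) : ℝ) = N := by
      rw [← Nat.cast_sum]
      simp
    rw [h3] at h1
    nlinarith
  · rw [hQ]
    linear_combination (Q a 0 + κ * r a) * hdsum r

end Core

/-! ### Tables whose moments factor both by rows and by columns -/

section RowFactor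

variable {I J : Type*} [DecidableEq I] [DecidableEq J]

theorem row_add_units_same (r : I × J → ℕ) (i : I) (j : J) (n : ℕ) :
    (fun l => (r + units (i, j) n) (i, l)) = (fun l => r (i, l)) + units j n := by
  ext l
  by_cases hl : l = j <;> simp [hl]

theorem row_add_units_of_ne (r : I × J → ℕ) {i k : I} (hk : k ≠ i) (j : J) (n : ℕ) :
    (fun l => (r + units (i, j) n) (k, l)) = fun l => r (k, l) := by
  ext l
  simp [hk]

theorem add_units_comp_swap (r : I × J → ℕ) (i : I) (j : J) (n : ℕ) :
    (r ∘ Prod.swap + units (j, i) n) ∘ Prod.swap = r + units (i, j) n := by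
  ext ⟨k, l⟩
  simp [Pi.single_apply, and_comm]

variable [Fintype I] [Fintype J]

theorem sum_comp_swap (r : I × J → ℕ) : ∑ a, (r ∘ Prod.swap) a = ∑ a, r a :=
  Equiv.sum_comp (Equiv.prodComm J I) r

/-- The moments `M` of a random table are the products of the moments `A` of its row sums and of the
moments `B i` of its normalized rows. -/
structure IsRowFactorization (M : (I × J → ℕ) → ℝ) (A : (I → ℕ) → ℝ) (B : I → (J → ℕ) → ℝ) :
    Prop where
  left_zero : A 0 = 1
  right_zero : ∀ i, B i 0 = 1
  pos_left : ∀ n, 0 < A n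
  pos_right : ∀ i m, 0 < B i m
  eq_mul : ∀ r, M r = A (fun i => ∑ j, r (i, j)) * ∏ i, B i (fun j => r (i, j))
  sum_left : ∀ n, ∑ i, A (n + units i 1) = A n
  sum_right : ∀ i m, ∑ j, B i (m + units j 1) = B i m

namespace IsRowFactorization

variable {M : (I × J → ℕ) → ℝ} {A : (I → ℕ) → ℝ} {B : I → (J → ℕ) → ℝ}

theorem pos (h : IsRowFactorization M A B) (r : I × J → ℕ) : 0 < M r := by
  rw [h.eq_mul]
  exact mul_pos (h.pos_left _) (Finset.prod_pos fun i _ => h.pos_right _ _)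

theorem rowSum_add_units (r : I × J → ℕ) (i : I) (j : J) (n : ℕ) :
    (fun k => ∑ l, (r + units (i, j) n) (k, l)) = (fun k => ∑ l, r (k, l)) + units i n := by
  ext k
  rcases eq_or_ne k i with rfl | hk
  · have := congrArg (fun f : J → ℕ => ∑ l, f l) (row_add_units_same r k j n)
    simp only [sum_add_units] at this
    rw [this]
    simp
  · have := congrArg (fun f : J → ℕ => ∑ l, f l) (row_add_units_of_ne r hk j n)
    rw [this]
    simp [hk]

theorem step (h : IsRowFactorization M A B) (r : I × J → ℕ) (i : I) (j : J) :
    M (r + units (i, j) 1) / M r =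
      A ((fun k => ∑ l, r (k, l)) + units i 1) / A (fun k => ∑ l, r (k, l)) *
        (B i ((fun l => r (i, l)) + units j 1) / B i (fun l => r (i, l))) := by
  have h1 : ∏ k ∈ Finset.univ.erase i, B k (fun l => (r + units (i, j) 1) (k, l)) =
      ∏ k ∈ Finset.univ.erase i, B k (fun l => r (k, l)) :=
    Finset.prod_congr rfl fun k hk => by rw [row_add_units_of_ne r (Finset.ne_of_mem_erase hk)]
  have h2 : ∏ k ∈ Finset.univ.erase i, B k (fun l => r (k, l)) ≠ 0 :=
    (Finset.prod_pos fun k _ => h.pos_right _ _).ne'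
  have h3 := (h.pos_left fun k => ∑ l, r (k, l)).ne'
  have h4 := (h.pos_right i fun l => r (i, l)).ne'
  rw [h.eq_mul, h.eq_mul, ← Finset.mul_prod_erase _ _ (Finset.mem_univ i),
    ← Finset.mul_prod_erase _ (fun i => B i fun j => r (i, j)) (Finset.mem_univ i), h1,
    row_add_units_same, rowSum_add_units]
  field_simp

theorem sum_step (h : IsRowFactorization M A B) (r : I × J → ℕ) (i : I) :
    ∑ j, M (r + units (i, j) 1) / M r =
      A ((fun k => ∑ l, r (k, l)) + units i 1) / A (fun k => ∑ l, r (k, l)) := by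
  simp only [h.step]
  rw [← Finset.mul_sum, ← Finset.sum_div, h.sum_right, div_self (h.pos_right _ _).ne', mul_one]

theorem sum_sum_step (h : IsRowFactorization M A B) (r : I × J → ℕ) :
    ∑ a, M (r + units a 1) / M r = 1 := by
  rw [Fintype.sum_prod_type]
  simp only [h.sum_step]
  rw [← Finset.sum_div, h.sum_left, div_self (h.pos_left _).ne']

/-- Moving a unit inside another row changes neither the row sums nor row `i`, and these are all
that the prediction at `(i, j)` uses. -/
theorem local_step (h : IsRowFactorization M A B) (r : I × J → ℕ) {i k : I} (hk : k ≠ i)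
    (j l l' : J) :
    M (r + units (k, l) 1 + units (i, j) 1) / M (r + units (k, l) 1) =
      M (r + units (k, l') 1 + units (i, j) 1) / M (r + units (k, l') 1) := by
  simp only [h.step, rowSum_add_units, row_add_units_of_ne r hk.symm]

/-- The factor of the row sums is common to the cells of a row and cancels in the ratio, which
therefore sees only that row. -/
theorem ratio_step (h : IsRowFactorization M A B) {r r' : I × J → ℕ} {i : I}
    (hr : ∀ l, r (i, l) = r' (i, l)) (j j' : J) :
    M (r + units (i, j) 1) / M r * (M (r' + units (i, j') 1) / M r') =
      M (r + units (i, j') 1) / M r * (M (r' + units (i, j) 1) / M r') := by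
  simp only [h.step, hr]
  ring

theorem zero (h : IsRowFactorization M A B) : M 0 = 1 := by
  have h1 := h.left_zero
  have h2 := h.right_zero
  simp only [Pi.zero_def] at h1 h2
  simp [h.eq_mul, h1, h2]

/-- The predictions over row `i` add up to a function of the row sums, which the transfer preserves.
By locality the other cells of the row contribute equally on both sides, so the two remaining terms
have the same sum. -/
theorem transfer_step (h : IsRowFactorization M A B)
    (hloc : ∀ (a : I × J) (r r' : I × J → ℕ), r a = r' a → ∑ t, r t = ∑ t, r' t →
      M (r + units a 1) / M r = M (r' + units a 1) / M r')
    (i : I) {j j' : J} (hj : j ≠ j') (s : I × J → ℕ) :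
    M (s + units (i, j) 1 + units (i, j) 1) / M (s + units (i, j) 1) +
        M (s + units (i, j) 1 + units (i, j') 1) / M (s + units (i, j) 1) =
      M (s + units (i, j') 1 + units (i, j) 1) / M (s + units (i, j') 1) +
        M (s + units (i, j') 1 + units (i, j') 1) / M (s + units (i, j') 1) := by
  have h1 := h.sum_step (s + units (i, j) 1) i
  have h2 := h.sum_step (s + units (i, j') 1) i
  rw [rowSum_add_units] at h1 h2
  rw [← h2] at h1
  have hmem : j' ∈ Finset.univ.erase j := by simp [hj.symm]
  rw [← Finset.add_sum_erase _ _ (Finset.mem_univ j), ← Finset.add_sum_erase _ _ hmem,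
    ← Finset.add_sum_erase Finset.univ
      (fun l => M (s + units (i, j') 1 + units (i, l) 1) / M (s + units (i, j') 1))
      (Finset.mem_univ j), ← Finset.add_sum_erase _ _ hmem] at h1
  have h3 : ∑ l ∈ (Finset.univ.erase j).erase j',
        M (s + units (i, j) 1 + units (i, l) 1) / M (s + units (i, j) 1) =
      ∑ l ∈ (Finset.univ.erase j).erase j',
        M (s + units (i, j') 1 + units (i, l) 1) / M (s + units (i, j') 1) := by
    refine Finset.sum_congr rfl fun l hl => ?_
    simp only [Finset.mem_erase] at hl
    refine hloc _ _ _ ?_ ?_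
    · simp [hl.1, hl.2.1]
    · simp only [sum_add_units]
  linarith

theorem swap_step (M : (I × J → ℕ) → ℝ) (r : I × J → ℕ) (i : I) (j : J) :
    M ((r ∘ Prod.swap + units (j, i) 1) ∘ Prod.swap) / M ((r ∘ Prod.swap) ∘ Prod.swap) =
      M (r + units (i, j) 1) / M r := by
  rw [add_units_comp_swap]
  rfl

theorem swap_step_add (M : (I × J → ℕ) → ℝ) (r : I × J → ℕ) (k i : I) (l j : J) :
    M ((r ∘ Prod.swap + units (l, k) 1 + units (j, i) 1) ∘ Prod.swap) /
        M ((r ∘ Prod.swap + units (l, k) 1) ∘ Prod.swap) =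
      M (r + units (k, l) 1 + units (i, j) 1) / M (r + units (k, l) 1) := by
  have h : r ∘ Prod.swap + units (l, k) 1 = (r + units (k, l) 1) ∘ Prod.swap := by
    ext ⟨a, b⟩
    simp [Pi.single_apply, and_comm]
  rw [h, swap_step]

theorem ratio_step_of_local [Nontrivial I] (h : IsRowFactorization M A B)
    (hloc : ∀ (a : I × J) (r r' : I × J → ℕ), r a = r' a → ∑ t, r t = ∑ t, r' t →
      M (r + units a 1) / M r = M (r' + units a 1) / M r')
    (i : I) {j j' : J} (hj : j ≠ j') {r r' : I × J → ℕ} (h1 : r (i, j) = r' (i, j))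
    (h2 : r (i, j') = r' (i, j')) :
    M (r + units (i, j) 1) / M r * (M (r' + units (i, j') 1) / M r') =
      M (r + units (i, j') 1) / M r * (M (r' + units (i, j) 1) / M r') := by
  obtain ⟨k, hk⟩ := exists_ne i
  have hle : ∀ r : I × J → ℕ, r (i, j) + r (i, j') ≤ ∑ t, r t := by
    intro r
    rw [← Finset.sum_pair (f := r) (by simpa using hj : (i, j) ≠ (i, j'))]
    exact Finset.sum_le_sum_of_subset (Finset.subset_univ _)
  -- All the units outside the two cells are sent to another row `k`. Locality permits this, and
  -- afterwards the two tables agree on the whole of row `i`.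
  set R : (I × J → ℕ) → I × J → ℕ := fun r => units (i, j) (r (i, j)) + units (i, j') (r (i, j')) +
    units (k, j) (∑ t, r t - r (i, j) - r (i, j')) with hR
  have hsum : ∀ r, ∑ t, r t = ∑ t, R r t :=
    fun r => (sum_units_add_units_add_units (hle r)).symm
  have hRj : ∀ r, r (i, j) = R r (i, j) := fun r => by simp [hR, hj, hk.symm]
  have hRj' : ∀ r, r (i, j') = R r (i, j') := fun r => by simp [hR, hj.symm]
  have hrow : ∀ l, R r (i, l) = R r' (i, l) := fun l => by
    simp [hR, h1, h2, hk.symm]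
  rw [hloc (i, j) r _ (hRj r) (hsum r), hloc (i, j') r _ (hRj' r) (hsum r),
    hloc (i, j) r' _ (hRj r') (hsum r'), hloc (i, j') r' _ (hRj' r') (hsum r')]
  exact h.ratio_step hrow j j'

variable {C : (J → ℕ) → ℝ} {D : J → (I → ℕ) → ℝ}

/-- Any unit outside `(i, j)` can reach `(i', j')` by moves that the prediction at `(i, j)` ignores:
inside rows other than `i` and inside columns other than `j`. -/
theorem step_eq_step [Nontrivial I] [Nontrivial J] (h : IsRowFactorization M A B)
    (h' : IsRowFactorization (fun r => M (r ∘ Prod.swap)) C D) (a : I × J) (r r' : I × J → ℕ)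
    (hr : r a = r' a) (hs : ∑ t, r t = ∑ t, r' t) :
    M (r + units a 1) / M r = M (r' + units a 1) / M r' := by
  obtain ⟨i, j⟩ := a
  obtain ⟨i', hi⟩ := exists_ne i
  obtain ⟨j', hj⟩ := exists_ne j
  have hrow : ∀ r k, k ≠ i → ∀ l l', M (r + units (k, l) 1 + units (i, j) 1) / M (r + units (k, l) 1) =
      M (r + units (k, l') 1 + units (i, j) 1) / M (r + units (k, l') 1) :=
    fun r k hk l l' => h.local_step r hk j l l'
  have hcol : ∀ r l, l ≠ j → ∀ k k', M (r + units (k, l) 1 + units (i, j) 1) / M (r + units (k, l) 1) =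
      M (r + units (k', l) 1 + units (i, j) 1) / M (r + units (k', l) 1) := by
    intro r l hl k k'
    have := h'.local_step (r ∘ Prod.swap) hl i k k'
    simpa only [swap_step_add] using this
  refine eq_of_apply_eq_of_sum_eq (fun r => M (r + units (i, j) 1) / M r) (t₁ := (i', j')) ?_ hr hs
  rintro r ⟨k, l⟩ hne
  by_cases hk : k = i
  · subst hk
    have hl : l ≠ j := by
      rintro rfl
      exact hne rfl
    exact (hcol r l hl k i').trans (hrow r i' hi l j')
  · exact (hrow r k hk l j').trans (hcol r j' hj k i')

theorem exists_affine [Nontrivial I] [Nontrivial J] (h : IsRowFactorization M A B)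
    (h' : IsRowFactorization (fun r => M (r ∘ Prod.swap)) C D) :
    ∃ κ : ℝ, 0 ≤ κ ∧ ∀ a r, M (r + units a 1) / M r * (1 + κ * ∑ t, (r t : ℝ)) =
      M (units a 1) + κ * r a := by
  have hloc := h.step_eq_step h'
  have hloc' : ∀ (a : J × I) (r r' : J × I → ℕ), r a = r' a → ∑ t, r t = ∑ t, r' t →
      M ((r + units a 1) ∘ Prod.swap) / M (r ∘ Prod.swap) =
        M ((r' + units a 1) ∘ Prod.swap) / M (r' ∘ Prod.swap) := by
    rintro ⟨j, i⟩ r r' hr hs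
    have := hloc (i, j) (r ∘ Prod.swap) (r' ∘ Prod.swap) hr
      (by rw [sum_comp_swap, sum_comp_swap, hs])
    rw [← swap_step, ← swap_step] at this
    exact this
  suffices H : ∃ κ : ℝ, 0 ≤ κ ∧ ∀ a r, M (r + units a 1) / M r * (1 + κ * ∑ t, (r t : ℝ)) =
      M (0 + units a 1) / M 0 + κ * r a by
    simpa [h.zero] using H
  -- Aligned cells are distinct cells in a common row or column; two of them in general position are
  -- joined through a corner.
  refine exists_affine_of_aligned (fun a r => M (r + units a 1) / M r)
    (fun a b => a ≠ b ∧ (a.1 = b.1 ∨ a.2 = b.2)) (fun a r => div_pos (h.pos _) (h.pos _))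
    h.sum_sum_step hloc ?_ ?_ (fun a b hab => hab.1) ?_ ?_ ?_
  · rintro f hf ⟨i, j⟩ ⟨i', j'⟩
    have h1 : f (i, j) = f (i, j') := by
      by_cases hj : j = j'
      · rw [hj]
      · exact hf _ _ ⟨by simp [hj], by simp⟩
    have h2 : f (i, j') = f (i', j') := by
      by_cases hi : i = i'
      · rw [hi]
      · exact hf _ _ ⟨by simp [hi], by simp⟩
    exact h1.trans h2
  · rintro ⟨i, j⟩
    obtain ⟨j', hj⟩ := exists_ne j
    exact ⟨(i, j'), by simp [hj.symm], by simp⟩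
  · rintro ⟨i, j⟩ ⟨i', j'⟩
    obtain ⟨k, hk⟩ := exists_ne i
    obtain ⟨l, hl⟩ := exists_ne j
    by_cases hi : i = i'
    · exact ⟨(k, l), by simp [hk], by simp [← hi, hk]⟩
    · by_cases hj : j = j'
      · exact ⟨(k, l), by simp [hk], by simp [← hj, hl]⟩
      · exact ⟨(i, j'), by simp [Ne.symm hj], by simp [hi]⟩
  · rintro ⟨i, j⟩ ⟨i', j'⟩ ⟨hne, h0⟩ s
    rcases h0 with h0 | h0 <;> dsimp only at h0 <;> subst h0
    · exact h.transfer_step hloc i (by simpa using hne) s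
    · have h2 := h'.transfer_step hloc' j (j := i) (j' := i') (by simpa using hne) (s ∘ Prod.swap)
      simpa only [swap_step_add] using h2
  · rintro ⟨i, j⟩ ⟨i', j'⟩ ⟨hne, h0⟩ r r' hra hrb
    rcases h0 with h0 | h0 <;> dsimp only at h0 <;> subst h0
    · exact h.ratio_step_of_local hloc i (by simpa using hne) hra hrb
    · have h2 := h'.ratio_step_of_local hloc' j (j := i) (j' := i') (by simpa using hne)
        (r := r ∘ Prod.swap) (r' := r' ∘ Prod.swap) hra hrb
      simpa only [swap_step] using h2

/-- Transposition keeps `κ`, so the same constant serves the column sums. -/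
theorem swap_affine {κ : ℝ}
    (H : ∀ a r, M (r + units a 1) / M r * (1 + κ * ∑ t, (r t : ℝ)) = M (units a 1) + κ * r a)
    (a : J × I) (r : J × I → ℕ) :
    M ((r + units a 1) ∘ Prod.swap) / M (r ∘ Prod.swap) * (1 + κ * ∑ t, (r t : ℝ)) =
      M (units a 1 ∘ Prod.swap) + κ * r a := by
  obtain ⟨j, i⟩ := a
  have h1 := H (i, j) (r ∘ Prod.swap)
  have h2 : units (j, i) 1 ∘ Prod.swap = units (i, j) 1 := by
    simpa using add_units_comp_swap (0 : I × J → ℕ) i j 1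
  have h3 : ∑ t, ((r ∘ Prod.swap) t : ℝ) = ∑ t, (r t : ℝ) := by
    rw [← Nat.cast_sum, sum_comp_swap, Nat.cast_sum]
  rw [h3, ← swap_step] at h1
  rw [h2]
  exact h1

/-- The moments of the row sums satisfy the recursion of Dirichlet moments. -/
theorem left_recursion [Nonempty J] (h : IsRowFactorization M A B) {κ : ℝ}
    (H : ∀ a r, M (r + units a 1) / M r * (1 + κ * ∑ t, (r t : ℝ)) = M (units a 1) + κ * r a)
    (n : I → ℕ) (i : I) :
    A (n + units i 1) * (1 + κ * ∑ k, (n k : ℝ)) = A n * (A (units i 1) + κ * n i) := by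
  have hsum : ∀ i, ∑ j, M (units (i, j) 1) = A (units i 1) := by
    intro i
    have := h.sum_step 0 i
    simpa [h.zero, h.left_zero, ← Pi.zero_def] using this
  obtain ⟨j₀⟩ : Nonempty J := inferInstance
  -- Any table with row sums `n` would do, since the sum of the predictions over a row depends on
  -- the row sums only.
  set r : I × J → ℕ := fun a => if a.2 = j₀ then n a.1 else 0 with hr
  have hrow : (fun k => ∑ l, r (k, l)) = n := by
    ext k
    simp [hr]
  have h1 := h.sum_step r i
  rw [hrow] at h1
  have h2 : ∑ t, (r t : ℝ) = ∑ k, (n k : ℝ) := by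
    rw [Fintype.sum_prod_type]
    simp [hr]
  have h3 : ∑ j, (r (i, j) : ℝ) = n i := by simp [hr]
  have h4 := Finset.sum_congr rfl fun j (_ : j ∈ Finset.univ) => H (i, j) r
  rw [← Finset.sum_mul, h1, h2, Finset.sum_add_distrib, hsum, ← Finset.mul_sum, h3] at h4
  rw [← h4]
  have := (h.pos_left n).ne'
  field_simp

/-- The moments of the normalized rows satisfy the recursion of Dirichlet moments. -/
theorem right_recursion (h : IsRowFactorization M A B) {κ : ℝ} (hκ : 0 ≤ κ)
    (H : ∀ a r, M (r + units a 1) / M r * (1 + κ * ∑ t, (r t : ℝ)) = M (units a 1) + κ * r a)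
    (i : I) (m : J → ℕ) (j : J) :
    B i (m + units j 1) * (A (units i 1) + κ * ∑ l, (m l : ℝ)) =
      B i m * (M (units (i, j) 1) + κ * m j) := by
  have hJ : Nonempty J := ⟨j⟩
  have hA := h.left_recursion H
  -- With all the units in row `i`, the prediction for the cell is the prediction for the row sum,
  -- known from `left_recursion`, times the one inside the row; division isolates the latter.
  set r : I × J → ℕ := fun a => if a.1 = i then m a.2 else 0 with hr
  have hrow : (fun k => ∑ l, r (k, l)) = units i (∑ l, m l) := by
    ext k
    rcases eq_or_ne k i with rfl | hk
    · simp [hr]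
    · simp [hr, hk]
  have h1 := h.step r i j
  rw [hrow] at h1
  have h2 : ∑ t, (r t : ℝ) = ∑ l, (m l : ℝ) := by
    rw [Fintype.sum_prod_type]
    simp [hr]
  have h3 : ∑ k, (units i (∑ l, m l) k : ℝ) = ∑ l, (m l : ℝ) := by
    rw [← Nat.cast_sum, ← Nat.cast_sum]
    simp
  have h4 := H (i, j) r
  have h5 := hA (units i (∑ l, m l)) i
  have h6 : (fun l => r (i, l)) = m := by
    ext l
    simp [hr]
  have h7 : r (i, j) = m j := by simp [hr]
  rw [h1, h2, h6, h7] at h4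
  rw [h3] at h5
  simp only [Pi.single_eq_same, Nat.cast_sum] at h5
  have p1 := h.pos_left (units i (∑ l, m l))
  have p2 := h.pos_right i m
  have p3 : (0 : ℝ) < 1 + κ * ∑ l, (m l : ℝ) := by positivity
  rw [← h4]
  field_simp
  linear_combination (-B i (m + units j 1)) * h5


end IsRowFactorization

end RowFactor

/-! ### Rooted trees, cliques and separators -/

section Tree

variable {V : Type*} [Fintype V] {G : SimpleGraph V} [DecidableRel G.Adj]

theorem mem_rootedParents {r u w : V} :
    u ∈ rootedParents G r w ↔ G.Adj u w ∧ G.dist r w = G.dist r u + 1 := by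
  simp [rootedParents]

theorem rootedParents_self (r : V) : rootedParents G r r = ∅ := by
  ext u
  simp [mem_rootedParents]

theorem notMem_rootedParents_self (r w : V) : w ∉ rootedParents G r w := by
  simp [mem_rootedParents]

/-- Shortest walks to either parent extend to paths from `r` to `w`, and a tree has only one such
path. -/
theorem eq_of_mem_rootedParents (hG : G.IsTree) {r u u' w : V} (hu : u ∈ rootedParents G r w)
    (hu' : u' ∈ rootedParents G r w) : u = u' := by
  rw [mem_rootedParents] at hu hu'
  obtain ⟨p, hp⟩ := hG.connected.exists_walk_length_eq_dist r u
  obtain ⟨p', hp'⟩ := hG.connected.exists_walk_length_eq_dist r u'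
  have h1 : (p.concat hu.1).IsPath := SimpleGraph.Walk.isPath_of_length_eq_dist _ (by simp [hp, hu.2])
  have h2 : (p'.concat hu'.1).IsPath :=
    SimpleGraph.Walk.isPath_of_length_eq_dist _ (by simp [hp', hu'.2])
  have h3 := (hG.existsUnique_path r w).unique h1 h2
  simpa using congrArg SimpleGraph.Walk.penultimate h3

theorem rootedParents_eq_singleton (hG : G.IsTree) {r u w : V} (hu : u ∈ rootedParents G r w) :
    rootedParents G r w = {u} :=
  Finset.eq_singleton_iff_unique_mem.2 ⟨hu, fun _ h => eq_of_mem_rootedParents hG h hu⟩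

theorem exists_rootedParents_eq_singleton (hG : G.IsTree) {r w : V} (hw : w ≠ r) :
    ∃ u, rootedParents G r w = {u} := by
  obtain ⟨p, hp⟩ := hG.connected.exists_walk_length_eq_dist r w
  have hn : ¬ p.Nil := fun h => hw h.eq.symm
  refine ⟨p.penultimate, rootedParents_eq_singleton hG (mem_rootedParents.2 ⟨p.adj_penultimate hn, ?_⟩)⟩
  have h1 : G.dist r p.penultimate ≤ p.length - 1 := by
    have := SimpleGraph.dist_le p.dropLast
    simpa using this
  have h2 : 0 < p.length := by
    rw [Nat.pos_iff_ne_zero]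
    intro h
    exact hn (SimpleGraph.Walk.length_eq_zero_iff.1 h)
  have h3 := hG.dist_eq_dist_add_one_of_adj r (p.adj_penultimate hn)
  omega

theorem mem_rootedParents_or (hG : G.IsTree) (r : V) {u w : V} (h : G.Adj u w) :
    u ∈ rootedParents G r w ∨ w ∈ rootedParents G r u := by
  rcases hG.dist_eq_dist_add_one_of_adj r h with h' | h'
  · exact Or.inr (mem_rootedParents.2 ⟨h.symm, h'⟩)
  · exact Or.inl (mem_rootedParents.2 ⟨h, h'⟩)

/-- This is what makes both orientations of every edge available although only leaves may serve as
roots. -/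
theorem exists_leaf_rootedParents_eq (hG : G.IsTree) {u w : V} (h : G.Adj u w) :
    ∃ r, G.degree r = 1 ∧ rootedParents G r w = {u} := by
  classical
  -- The root is a vertex farthest from `w` among those behind `u`. A second neighbour of it would
  -- be farther from `w` and still behind `u`.
  obtain ⟨r, hr, hmax⟩ := Finset.exists_max_image
    (Finset.univ.filter fun x => G.dist x w = G.dist x u + 1) (fun x => G.dist x w)
    ⟨u, by simp [h]⟩
  simp only [Finset.mem_filter, Finset.mem_univ, true_and] at hr hmax
  refine ⟨r, ?_, rootedParents_eq_singleton hG (mem_rootedParents.2 ⟨h, hr⟩)⟩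
  have hrw : r ≠ w := by
    rintro rfl
    simp at hr
  obtain ⟨y, hy⟩ := exists_rootedParents_eq_singleton hG hrw
  rw [SimpleGraph.degree, Finset.card_eq_one]
  refine ⟨y, ?_⟩
  have hy' := mem_rootedParents.1 (hy ▸ Finset.mem_singleton_self y)
  rw [Finset.eq_singleton_iff_unique_mem]
  refine ⟨by simpa using hy'.1.symm, fun z hz => ?_⟩
  rw [SimpleGraph.mem_neighborFinset] at hz
  by_contra hne
  rcases mem_rootedParents_or hG w hz with h1 | h1
  · rw [mem_rootedParents, SimpleGraph.dist_comm, SimpleGraph.dist_comm (u := w)] at h1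
    have h2 := hG.connected.dist_triangle (u := z) (v := u) (w := w)
    have h3 := hG.connected.dist_triangle (u := z) (v := r) (w := u)
    rw [SimpleGraph.dist_eq_one_iff_adj.2 h] at h2
    rw [SimpleGraph.dist_eq_one_iff_adj.2 hz.symm] at h3
    have := hmax z (by omega)
    omega
  · exact hne (by simpa [hy] using h1)

variable [DecidableEq V]

/-- A third vertex of the clique would be at distance one from both ends of an edge, but in a tree
these distances differ. -/
theorem maximal_isClique_pair (hG : G.IsTree) {u w : V} (h : G.Adj u w) :
    Maximal (fun s : Finset V => G.IsClique (s : Set V)) {u, w} := by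
  refine ⟨by simpa using fun _ => h, fun t ht hle x hx => ?_⟩
  by_contra hne
  simp only [Finset.mem_insert, Finset.mem_singleton, not_or] at hne
  have hu : G.Adj x u := ht hx (hle (by simp)) hne.1
  have hw : G.Adj x w := ht hx (hle (by simp)) hne.2
  exact hG.dist_ne_of_adj x h
    ((SimpleGraph.dist_eq_one_iff_adj.2 hu).trans (SimpleGraph.dist_eq_one_iff_adj.2 hw).symm)

theorem maximal_isClique_iff [Nontrivial V] (hG : G.IsTree) {D : Finset V} :
    Maximal (fun s : Finset V => G.IsClique (s : Set V)) D ↔ ∃ u w, G.Adj u w ∧ D = {u, w} := by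
  constructor
  · intro hD
    by_cases h : (D : Set V).Subsingleton
    · obtain ⟨v, hv⟩ : ∃ v, D ⊆ {v} := by
        rcases D.eq_empty_or_nonempty with rfl | ⟨v, hv⟩
        · exact ⟨hG.connected.nonempty.some, by simp⟩
        · exact ⟨v, fun x hx => by simpa using h hx hv⟩
      obtain ⟨u, hu⟩ := hG.connected.preconnected.exists_adj_of_nontrivial v
      have h1 := hD.eq_of_le (maximal_isClique_pair hG hu).1 (hv.trans (by simp))
      exact ⟨v, u, hu, h1⟩
    · rw [Set.not_subsingleton_iff] at h
      obtain ⟨a, ha, b, hb, hab⟩ := h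
      have hadj : G.Adj a b := hD.1 ha hb hab
      refine ⟨a, b, hadj, ((maximal_isClique_pair hG hadj).eq_of_le hD.1 ?_).symm⟩
      intro x hx
      simp only [Finset.mem_insert, Finset.mem_singleton] at hx
      rcases hx with rfl | rfl
      exacts [ha, hb]
  · rintro ⟨u, w, h, rfl⟩
    exact maximal_isClique_pair hG h

namespace IsPerfectOrder

variable {K : ℕ} {C : Fin K → Finset V}

theorem image_eq [Nontrivial V] (hC : IsPerfectOrder G C) (hG : G.IsTree) (r : V) :
    Finset.univ.image C =
      (Finset.univ.erase r).image fun w => insert w (rootedParents G r w) := by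
  ext D
  have h1 : D ∈ Finset.univ.image C ↔ D ∈ Set.range C := by simp
  rw [h1, hC.mem_range_iff, maximal_isClique_iff hG]
  simp only [Finset.mem_image, Finset.mem_erase, Finset.mem_univ, and_true]
  constructor
  · rintro ⟨u, w, h, rfl⟩
    have hne : ∀ {a b}, a ∈ rootedParents G r b → b ≠ r := by
      rintro a b hab rfl
      simp [rootedParents_self] at hab
    rcases mem_rootedParents_or hG r h with h | h
    · exact ⟨w, hne h, by rw [rootedParents_eq_singleton hG h, Finset.pair_comm]⟩
    · exact ⟨u, hne h, by rw [rootedParents_eq_singleton hG h]⟩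
  · rintro ⟨w, hw, rfl⟩
    obtain ⟨u, hu⟩ := exists_rootedParents_eq_singleton hG hw
    have h := (mem_rootedParents.1 (hu ▸ Finset.mem_singleton_self u : u ∈ rootedParents G r w)).1
    exact ⟨w, u, h.symm, by rw [hu]⟩

theorem injOn_insert_rootedParents (r : V) :
    Set.InjOn (fun w => insert w (rootedParents G r w)) ((Finset.univ.erase r : Finset V) : Set V) := by
  intro a _ b _ hab
  by_contra hne
  simp only at hab
  have h1 : a ∈ insert b (rootedParents G r b) := hab ▸ Finset.mem_insert_self a _
  have h2 : b ∈ insert a (rootedParents G r a) := hab ▸ Finset.mem_insert_self b _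
  simp only [Finset.mem_insert, hne, Ne.symm hne, false_or, mem_rootedParents] at h1 h2
  omega

theorem prod_eq {M : Type*} [CommMonoid M] [Nontrivial V] (hC : IsPerfectOrder G C) (hG : G.IsTree)
    (r : V) (F : Finset V → M) :
    ∏ l, F (C l) = ∏ w ∈ Finset.univ.erase r, F (insert w (rootedParents G r w)) := by
  rw [← Finset.prod_image (f := F) (fun a _ b _ h => hC.injective h), hC.image_eq hG r,
    Finset.prod_image (injOn_insert_rootedParents r)]

theorem card_add_one [Nontrivial V] (hC : IsPerfectOrder G C) (hG : G.IsTree) :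
    K + 1 = Fintype.card V := by
  have r : V := hG.connected.nonempty.some
  have h := congrArg Finset.card (hC.image_eq hG r)
  rw [Finset.card_image_of_injective _ hC.injective,
    Finset.card_image_of_injOn (injOn_insert_rootedParents r), Finset.card_erase_of_mem (by simp)] at h
  simp only [Finset.card_univ, Fintype.card_fin] at h
  have := Fintype.card_pos (α := V)
  omega

theorem card_eq_two [Nontrivial V] (hC : IsPerfectOrder G C) (hG : G.IsTree) (l : Fin K) :
    (C l).card = 2 := by
  obtain ⟨u, w, h, hl⟩ := (maximal_isClique_iff hG).1 ((hC.mem_range_iff _).1 ⟨l, rfl⟩)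
  rw [hl, Finset.card_pair h.ne]

/-- A separator with two elements would fill both its own clique and an earlier one, which are
distinct. -/
theorem card_separator_le_one [Nontrivial V] (hC : IsPerfectOrder G C) (hG : G.IsTree) (l : Fin K) :
    (separator C l).card ≤ 1 := by
  rcases Nat.eq_zero_or_pos (l : ℕ) with h | h
  · have : Finset.Iio l = ∅ := by
      ext x
      simp [Fin.lt_def, h]
    simp [separator, this]
  · obtain ⟨i, hi, hsub⟩ := hC.perfect l h
    have hsub' : separator C l ⊆ C l := Finset.inter_subset_left
    by_contra! hlt
    have h1 := Finset.eq_of_subset_of_card_le hsub (by rw [hC.card_eq_two hG]; omega)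
    have h2 := Finset.eq_of_subset_of_card_le hsub' (by rw [hC.card_eq_two hG]; omega)
    exact hi.ne (hC.injective (h1.symm.trans h2))

/-- A vertex lies in the separator of each clique that contains it, except for the first such
clique. -/
theorem card_filter_mem_eq [Nontrivial V] (hC : IsPerfectOrder G C) (hG : G.IsTree) (u : V) :
    (Finset.univ.filter fun l => u ∈ C l).card =
      (Finset.univ.filter fun l => u ∈ separator C l).card + 1 := by
  have hne : (Finset.univ.filter fun l => u ∈ C l).Nonempty := by
    obtain ⟨w, hw⟩ := hG.connected.preconnected.exists_adj_of_nontrivial u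
    obtain ⟨l, hl⟩ := (hC.mem_range_iff _).2 (maximal_isClique_pair hG hw)
    exact ⟨l, by simp [hl]⟩
  have hmem := Finset.min'_mem _ hne
  have hmin := fun l hl => Finset.min'_le (Finset.univ.filter fun l => u ∈ C l) l hl
  set l₀ := (Finset.univ.filter fun l => u ∈ C l).min' hne with hl₀
  have : (Finset.univ.filter fun l => u ∈ separator C l) =
      (Finset.univ.filter fun l => u ∈ C l).erase l₀ := by
    ext l
    simp only [Finset.mem_filter, Finset.mem_univ, true_and, Finset.mem_erase, separator,
      Finset.mem_inter, Finset.mem_biUnion, Finset.mem_Iio] at hmin hmem ⊢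
    constructor
    · rintro ⟨h, i, hi, hui⟩
      exact ⟨((hmin i hui).trans_lt hi).ne', h⟩
    · rintro ⟨hne, h⟩
      exact ⟨h, l₀, lt_of_le_of_ne (hmin l h) (Ne.symm hne), hmem⟩
  rw [this, Finset.card_erase_of_mem hmem]
  have := Finset.card_pos.2 hne
  omega

/-- Parent sets and separators are the same singletons with the same multiplicities, up to one extra
occurrence of the root: in both cases a vertex is counted once per clique containing it, with one
correction. -/
theorem card_filter_mem_rootedParents [Nontrivial V] (hC : IsPerfectOrder G C) (hG : G.IsTree)
    (r u : V) :
    (Finset.univ.filter fun w => u ∈ rootedParents G r w).card =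
      (Finset.univ.filter fun l => u ∈ separator C l).card + if u = r then 1 else 0 := by
  have h1 := hC.card_filter_mem_eq hG u
  have h2 := hC.prod_eq (M := Multiplicative ℕ) hG r
    fun D => Multiplicative.ofAdd (if u ∈ D then 1 else 0)
  have h3 : ∑ l, (if u ∈ C l then 1 else 0) =
      ∑ w ∈ Finset.univ.erase r, if u ∈ insert w (rootedParents G r w) then 1 else 0 := h2
  have h4 : ∑ w ∈ Finset.univ.erase r, (if u ∈ insert w (rootedParents G r w) then 1 else 0) =
      ∑ w ∈ Finset.univ.erase r, ((if u = w then 1 else 0) +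
        if u ∈ rootedParents G r w then 1 else 0) := by
    refine Finset.sum_congr rfl fun w _ => ?_
    by_cases huw : u = w
    · subst huw
      simp [notMem_rootedParents_self]
    · simp [huw]
  have h5 : ∑ w, (if u ∈ rootedParents G r w then 1 else 0) =
      ∑ w ∈ Finset.univ.erase r, if u ∈ rootedParents G r w then 1 else 0 := by
    rw [← Finset.add_sum_erase _ _ (Finset.mem_univ r)]
    simp [rootedParents_self]
  rw [h4, Finset.sum_add_distrib, ← h5, ← Finset.card_filter, ← Finset.card_filter, h1] at h3
  have h6 : ((Finset.univ.erase r).filter fun i => u = i).card = if u = r then 0 else 1 := by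
    rw [Finset.filter_eq]
    by_cases hu : u = r <;> simp [hu]
  rw [h6, ← Finset.card_filter] at h3
  split_ifs at h3 ⊢ <;> omega

theorem eq_mul_prod_of_card_le_one (F : Finset V → ℝ) (hF : ∀ D, F D ≠ 0) {S : Finset V}
    (hS : S.card ≤ 1) : F S = F ∅ * ∏ u ∈ S, F {u} / F ∅ := by
  rcases S.eq_empty_or_nonempty with rfl | hne
  · simp
  · obtain ⟨v, rfl⟩ := Finset.card_eq_one.1 (le_antisymm hS (Finset.card_pos.2 hne))
    rw [Finset.prod_singleton, mul_div_cancel₀ _ (hF ∅)]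

theorem prod_eq_pow_mul_prod {ι : Type*} [Fintype ι] (F : Finset V → ℝ) (hF : ∀ D, F D ≠ 0)
    (S : ι → Finset V) (hS : ∀ i, (S i).card ≤ 1) :
    ∏ i, F (S i) =
      F ∅ ^ Fintype.card ι * ∏ u, (F {u} / F ∅) ^ (Finset.univ.filter fun i => u ∈ S i).card := by
  rw [Finset.prod_congr rfl fun i _ => eq_mul_prod_of_card_le_one F hF (hS i),
    Finset.prod_mul_distrib, Finset.prod_const, Finset.card_univ]
  congr 1
  rw [Finset.prod_comm' (t' := Finset.univ) (s' := fun u => Finset.univ.filter fun i => u ∈ S i)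
    (by simp)]
  simp only [Finset.prod_const]

/-- A product over cliques and separators is a product over the vertices and their parents. -/
theorem prod_div_prod_separator [Nontrivial V] (hC : IsPerfectOrder G C) (hG : G.IsTree) (r : V)
    (F : Finset V → ℝ) (hF : ∀ D, F D ≠ 0) :
    (∏ l, F (C l)) / ∏ l, F (separator C l) =
      ∏ w, F (insert w (rootedParents G r w)) / F (rootedParents G r w) := by
  have hpa : ∀ w, (rootedParents G r w).card ≤ 1 := fun w =>
    Finset.card_le_one.2 fun a ha b hb => eq_of_mem_rootedParents hG ha hb
  -- There are `K + 1` parent sets and `K` separators. The extra factor `F ∅` combines with the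
  -- extra `F {r} / F ∅` into `F {r}`.
  have h1 : ∏ w, F (rootedParents G r w) = F {r} * ∏ l, F (separator C l) := by
    rw [prod_eq_pow_mul_prod F hF _ hpa,
      prod_eq_pow_mul_prod F hF _ (hC.card_separator_le_one hG), Fintype.card_fin,
      ← hC.card_add_one hG]
    simp only [hC.card_filter_mem_rootedParents hG, pow_add, Finset.prod_mul_distrib]
    have : ∏ u, (F {u} / F ∅) ^ (if u = r then 1 else 0) = F {r} / F ∅ := by
      rw [Finset.prod_eq_single r (fun b _ hb => by simp [hb]) (by simp)]
      simp
    rw [this]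
    have := hF ∅
    field_simp
  have h2 : ∏ w, F (insert w (rootedParents G r w)) = F {r} * ∏ l, F (C l) := by
    rw [hC.prod_eq hG r, ← Finset.mul_prod_erase _ _ (Finset.mem_univ r), rootedParents_self]
    simp
  rw [Finset.prod_div_distrib, h1, h2, mul_div_mul_left _ _ (hF _)]

end IsPerfectOrder

end Tree

/-! ### Moments of random vectors in the simplex -/

section RandomSimplex

variable {Ω : Type*} [MeasurableSpace Ω] {T : Type*} [Fintype T]

/-- The moments of a random vector. -/
noncomputable def moment (μ : Measure Ω) (X : Ω → T → ℝ) (n : T → ℕ) : ℝ :=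
  ∫ ω, ∏ t, X ω t ^ n t ∂μ

/-- A random vector with values in the open simplex. -/
structure IsRandomSimplex (μ : Measure Ω) (X : Ω → T → ℝ) : Prop where
  measurable : Measurable X
  pos : ∀ᵐ ω ∂μ, ∀ t, 0 < X ω t
  sum_eq_one : ∀ᵐ ω ∂μ, ∑ t, X ω t = 1

theorem moment_congr {μ : Measure Ω} {X Y : Ω → T → ℝ} (h : ∀ᵐ ω ∂μ, ∀ t, X ω t = Y ω t)
    (n : T → ℕ) : moment μ X n = moment μ Y n := by
  refine integral_congr_ae ?_
  filter_upwards [h] with ω hω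
  simp only [hω]

namespace IsRandomSimplex

variable {μ : Measure Ω} [IsProbabilityMeasure μ] {X : Ω → T → ℝ}

theorem measurable_prod_pow (hX : IsRandomSimplex μ X) (n : T → ℕ) :
    Measurable fun ω => ∏ t, X ω t ^ n t :=
  Finset.measurable_fun_prod _ fun t _ => (measurable_pi_iff.1 hX.measurable t).pow_const _

theorem integrable (hX : IsRandomSimplex μ X) (n : T → ℕ) :
    Integrable (fun ω => ∏ t, X ω t ^ n t) μ := by
  refine Integrable.of_bound (hX.measurable_prod_pow n).aestronglyMeasurable 1 ?_
  filter_upwards [hX.pos, hX.sum_eq_one] with ω h1 h2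
  have h3 : ∀ t, X ω t ≤ 1 := fun t => by
    rw [← h2]
    exact Finset.single_le_sum (fun s _ => (h1 s).le) (Finset.mem_univ t)
  rw [Real.norm_of_nonneg (Finset.prod_nonneg fun t _ => pow_nonneg (h1 t).le _)]
  exact Finset.prod_le_one (fun t _ => pow_nonneg (h1 t).le _)
    fun t _ => pow_le_one₀ (h1 t).le (h3 t)

theorem moment_zero : moment μ X 0 = 1 := by
  simp [moment]

theorem moment_pos (hX : IsRandomSimplex μ X) (n : T → ℕ) : 0 < moment μ X n := by
  have h0 : ∀ᵐ ω ∂μ, 0 < ∏ t, X ω t ^ n t := by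
    filter_upwards [hX.pos] with ω h
    exact Finset.prod_pos fun t _ => pow_pos (h t) _
  refine lt_of_le_of_ne (integral_nonneg_of_ae (h0.mono fun ω h => h.le)) fun h => ?_
  have h1 := (integral_eq_zero_iff_of_nonneg_ae (h0.mono fun ω h => h.le) (hX.integrable n)).1 h.symm
  obtain ⟨ω, h2, h3⟩ := (h0.and h1).exists
  exact h2.ne' h3

variable [DecidableEq T]

theorem prod_pow_add_units (x : T → ℝ) (n : T → ℕ) (t : T) :
    ∏ s, x s ^ (n + units t 1) s = (∏ s, x s ^ n s) * x t := by
  simp only [Pi.add_apply, pow_add, Finset.prod_mul_distrib]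
  congr 1
  rw [Finset.prod_eq_single t (fun b _ hb => by simp [hb]) (by simp)]
  simp

theorem sum_moment_add_units (hX : IsRandomSimplex μ X) (n : T → ℕ) :
    ∑ t, moment μ X (n + units t 1) = moment μ X n := by
  unfold moment
  rw [← integral_finsetSum _ fun t _ => hX.integrable _]
  refine integral_congr_ae ?_
  filter_upwards [hX.sum_eq_one] with ω h
  simp only [prod_pow_add_units, ← Finset.mul_sum, h, mul_one]

omit [IsProbabilityMeasure μ] in
theorem moment_units (t : T) : moment μ X (units t 1) = ∫ ω, X ω t ∂μ := by
  unfold moment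
  refine integral_congr_ae (Filter.Eventually.of_forall fun ω => ?_)
  have := prod_pow_add_units (X ω) 0 t
  simpa using this

/-- The hypothesis says that the variance vanishes. -/
theorem ae_eq_const_of_moment (hX : IsRandomSimplex μ X) {t : T}
    (h : moment μ X (units t 1 + units t 1) = moment μ X (units t 1) ^ 2) :
    ∀ᵐ ω ∂μ, X ω t = moment μ X (units t 1) := by
  set c := moment μ X (units t 1) with hc
  have e1 : ∀ ω, ∏ s, X ω s ^ units t 1 s = X ω t := fun ω => by
    simpa using prod_pow_add_units (X ω) 0 t
  have e2 : ∀ ω, ∏ s, X ω s ^ (units t 1 + units t 1) s = X ω t * X ω t := fun ω => by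
    rw [prod_pow_add_units, e1]
  have i1 := hX.integrable (units t 1)
  have i2 := hX.integrable (units t 1 + units t 1)
  simp only [e1] at i1
  simp only [e2] at i2
  have m1 : ∫ ω, X ω t ∂μ = c := (moment_units t).symm
  have m2 : ∫ ω, X ω t * X ω t ∂μ = c ^ 2 := by
    rw [← h]
    simp only [moment, e2]
  have i3 : Integrable (fun ω => (X ω t - c) ^ 2) μ := by
    have : (fun ω => (X ω t - c) ^ 2) = fun ω => X ω t * X ω t - 2 * c * X ω t + c ^ 2 := by
      ext ω
      ring
    rw [this]
    exact (i2.sub (i1.const_mul _)).add (integrable_const _)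
  have h0 : ∫ ω, (X ω t - c) ^ 2 ∂μ = 0 := by
    have : (fun ω => (X ω t - c) ^ 2) = fun ω => X ω t * X ω t - 2 * c * X ω t + c ^ 2 := by
      ext ω
      ring
    rw [this, integral_add (f := fun ω => X ω t * X ω t - 2 * c * X ω t)
      (i2.sub (i1.const_mul _)) (integrable_const _), integral_sub i2 (i1.const_mul _),
      integral_const_mul, m1, m2]
    simp
    ring
  have h1 := (integral_eq_zero_iff_of_nonneg (fun ω => sq_nonneg (X ω t - c)) i3).1 h0
  filter_upwards [h1] with ω hω
  have := pow_eq_zero_iff (two_ne_zero) |>.1 hω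
  linarith

end IsRandomSimplex

end RandomSimplex

/-! ### Cells of one or two vertices -/

section Cells

variable {V : Type*} [DecidableEq V] {I : V → Type*}

/-- A cell of `insert w D` is a cell of `D` and an element of `I w`. -/
def consCell {D : Finset V} {w : V} (hw : w ∉ D) :
    (∀ u : D, I u) × I w ≃ (∀ u : (insert w D : Finset V), I u) where
  toFun k x := if h : x.1 = w then cast (by rw [h]) k.2 else
    k.1 ⟨x.1, Finset.mem_of_mem_insert_of_ne x.2 h⟩
  invFun c := (Finset.restrict₂ (Finset.subset_insert w D) c, c ⟨w, Finset.mem_insert_self w D⟩)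
  left_inv := by
    rintro ⟨k, l⟩
    ext x
    · have : x.1 ≠ w := fun h => hw (h ▸ x.2)
      simp [this]
    · simp
  right_inv c := by
    ext ⟨x, hx⟩
    by_cases h : x = w
    · subst h
      simp
    · simp [h]

theorem restrict_eq_consCell_iff {D : Finset V} {w : V} (hw : w ∉ D) (i : ∀ v, I v)
    (k : ∀ u : D, I u) (l : I w) :
    (insert w D).restrict i = consCell hw (k, l) ↔ D.restrict i = k ∧ i w = l := by
  rw [← Equiv.symm_apply_eq, Prod.ext_iff]
  rfl

/-- A cell of a single vertex. -/
def singletonCell (u : V) : I u ≃ (∀ x : ({u} : Finset V), I x) where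
  toFun k x := cast (by rw [Finset.mem_singleton.1 x.2]) k
  invFun c := c ⟨u, Finset.mem_singleton_self u⟩
  left_inv k := rfl
  right_inv c := by
    ext ⟨x, hx⟩
    obtain rfl := Finset.mem_singleton.1 hx
    rfl

theorem restrict_singleton_eq_iff {u : V} (i : ∀ v, I v) (c : ∀ x : ({u} : Finset V), I x) :
    Finset.restrict {u} i = c ↔ i u = c ⟨u, Finset.mem_singleton_self u⟩ := by
  constructor
  · rintro rfl
    rfl
  · intro h
    ext ⟨x, hx⟩
    obtain rfl := Finset.mem_singleton.1 hx
    exact h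

theorem exists_restrict_eq (i₀ : ∀ v, I v) (D : Finset V) (k : ∀ u : D, I u) :
    ∃ i : ∀ v, I v, D.restrict i = k :=
  ⟨fun v => if h : v ∈ D then k ⟨v, h⟩ else i₀ v, by ext x; simp⟩

end Cells

/-! ### Marginals and factorization along a rooted tree -/

section Marginals

variable {V : Type*} [Fintype V] [DecidableEq V]
variable {I : V → Type*} [∀ v, Fintype (I v)] [∀ v, DecidableEq (I v)]

/-- The marginal of a table at a vertex. -/
def vertexMarginal (q : (∀ v, I v) → ℝ) (u : V) (k : I u) : ℝ :=
  ∑ i with i u = k, q i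

/-- The marginal of a table at a pair of vertices. -/
def edgeMarginal (q : (∀ v, I v) → ℝ) (u w : V) (a : I u × I w) : ℝ :=
  ∑ i with i u = a.1 ∧ i w = a.2, q i

theorem sum_marginal_restrict₂ {M : Type*} [AddCommMonoid M] (q : (∀ v, I v) → M)
    {S C : Finset V} (h : S ⊆ C) (s : ∀ u : S, I u) :
    ∑ k with Finset.restrict₂ h k = s, marginal q C k = marginal q S s := by
  unfold marginal
  rw [← Finset.sum_fiberwise_of_maps_to (s := Finset.univ.filter fun i => S.restrict i = s)
    (t := Finset.univ.filter fun k => Finset.restrict₂ h k = s) (g := C.restrict)]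
  · refine Finset.sum_congr rfl fun k hk => ?_
    congr 1
    ext i
    simp only [Finset.mem_filter, Finset.mem_univ, true_and] at hk ⊢
    constructor
    · rintro rfl
      exact ⟨hk, rfl⟩
    · exact fun h => h.2
  · intro i hi
    rw [Finset.mem_filter] at hi ⊢
    exact ⟨Finset.mem_univ _, hi.2⟩

theorem prod_pow_marginal {M : Type*} [CommMonoid M] (r : (∀ v, I v) → ℕ) (D : Finset V)
    (φ : (∀ u : D, I u) → M) :
    ∏ i, φ (D.restrict i) ^ r i = ∏ k, φ k ^ marginal r D k := by
  rw [← Finset.prod_fiberwise Finset.univ D.restrict]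
  refine Finset.prod_congr rfl fun k _ => ?_
  rw [marginal, ← Finset.prod_pow_eq_pow_sum]
  refine Finset.prod_congr rfl fun i hi => ?_
  rw [(Finset.mem_filter.1 hi).2]

theorem sum_marginal_consCell {M : Type*} [AddCommMonoid M] (q : (∀ v, I v) → M) {D : Finset V}
    {w : V} (hw : w ∉ D) (k : ∀ u : D, I u) :
    ∑ l, marginal q (insert w D) (consCell hw (k, l)) = marginal q D k := by
  unfold marginal
  simp only [restrict_eq_consCell_iff]
  rw [← Finset.sum_fiberwise (Finset.univ.filter fun i => D.restrict i = k) (fun i => i w)]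
  simp only [Finset.filter_filter]

theorem condProb_eq (q : (∀ v, I v) → ℝ) {D : Finset V} {w : V} (hw : w ∉ D)
    (k : ∀ u : D, I u) (l : I w) :
    condProb q w D k l = marginal q (insert w D) (consCell hw (k, l)) / marginal q D k := by
  simp only [condProb, marginal, restrict_eq_consCell_iff]

theorem marginal_singleton (q : (∀ v, I v) → ℝ) (u : V) (c : ∀ x : ({u} : Finset V), I x) :
    marginal q {u} c = vertexMarginal q u (c ⟨u, Finset.mem_singleton_self u⟩) := by
  simp only [marginal, vertexMarginal, restrict_singleton_eq_iff]

theorem marginal_empty (q : (∀ v, I v) → ℝ) (c : ∀ x : (∅ : Finset V), I x) :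
    marginal q ∅ c = ∑ i, q i := by
  rw [marginal, Finset.filter_true_of_mem]
  intro i _
  ext ⟨x, hx⟩
  simp at hx

theorem marginal_consCell_singleton (q : (∀ v, I v) → ℝ) {u w : V} (hw : w ∉ ({u} : Finset V))
    (c : ∀ x : ({u} : Finset V), I x) (l : I w) :
    marginal q (insert w {u}) (consCell hw (c, l)) =
      edgeMarginal q u w (c ⟨u, Finset.mem_singleton_self u⟩, l) := by
  simp only [marginal, edgeMarginal, restrict_eq_consCell_iff, restrict_singleton_eq_iff]

theorem marginal_consCell_empty (q : (∀ v, I v) → ℝ) {w : V} (hw : w ∉ (∅ : Finset V))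
    (c : ∀ x : (∅ : Finset V), I x) (l : I w) :
    marginal q (insert w ∅) (consCell hw (c, l)) = vertexMarginal q w l := by
  have h : ∀ i : ∀ v, I v, Finset.restrict ∅ i = c := fun i => by
    ext ⟨x, hx⟩
    simp at hx
  simp only [marginal, vertexMarginal, restrict_eq_consCell_iff, h, true_and]

theorem edgeMarginal_swap (q : (∀ v, I v) → ℝ) (u w : V) (a : I u × I w) :
    edgeMarginal q w u a.swap = edgeMarginal q u w a := by
  simp only [edgeMarginal, Prod.fst_swap, Prod.snd_swap, and_comm]

theorem sum_edgeMarginal (q : (∀ v, I v) → ℝ) (u w : V) (k : I u) :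
    ∑ l, edgeMarginal q u w (k, l) = vertexMarginal q u k := by
  unfold edgeMarginal vertexMarginal
  rw [← Finset.sum_fiberwise (Finset.univ.filter fun i : ∀ v, I v => i u = k)
    (fun i => i w)]
  simp only [Finset.filter_filter]

theorem sum_vertexMarginal (q : (∀ v, I v) → ℝ) (u : V) :
    ∑ k, vertexMarginal q u k = ∑ i, q i :=
  Finset.sum_fiberwise Finset.univ (fun i : ∀ v, I v => i u) q

/-- The law of total probability. -/
theorem sum_marginal_mul_condProb (q : (∀ v, I v) → ℝ) {D : Finset V} {w : V}
    (hq : ∀ k, marginal q D k ≠ 0) (l : I w) :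
    ∑ k, marginal q D k * condProb q w D k l = vertexMarginal q w l := by
  have h : ∀ k, marginal q D k * condProb q w D k l = ∑ i with D.restrict i = k ∧ i w = l, q i :=
    fun k => by rw [condProb, mul_div_cancel₀ _ (hq k)]
  simp only [h]
  rw [vertexMarginal, ← Finset.sum_fiberwise (Finset.univ.filter fun i : ∀ v, I v => i w = l)
    D.restrict]
  simp only [Finset.filter_filter, and_comm]

section Positive

variable {q : (∀ v, I v) → ℝ} (hq : ∀ i, 0 < q i)

include hq

theorem marginal_pos [Nonempty (∀ v, I v)] (D : Finset V) (k : ∀ u : D, I u) :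
    0 < marginal q D k := by
  obtain ⟨i, hi⟩ := exists_restrict_eq (Classical.arbitrary _) D k
  exact Finset.sum_pos (fun i _ => hq i) ⟨i, by simpa using hi⟩

theorem vertexMarginal_pos [Nonempty (∀ v, I v)] (u : V) (k : I u) : 0 < vertexMarginal q u k :=
  Finset.sum_pos (fun i _ => hq i) ⟨Function.update (Classical.arbitrary _) u k, by simp⟩

theorem edgeMarginal_pos [Nonempty (∀ v, I v)] {u w : V} (h : u ≠ w) (a : I u × I w) :
    0 < edgeMarginal q u w a :=
  Finset.sum_pos (fun i _ => hq i)
    ⟨Function.update (Function.update (Classical.arbitrary _) u a.1) w a.2, by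
      simp [Function.update_of_ne h]⟩

end Positive

theorem measurable_marginal (D : Finset V) (k : ∀ u : D, I u) :
    Measurable fun q : (∀ v, I v) → ℝ => marginal q D k :=
  Finset.measurable_fun_sum _ fun i _ => measurable_pi_apply i

theorem measurable_vertexMarginal (u : V) :
    Measurable fun q : (∀ v, I v) → ℝ => vertexMarginal q u :=
  measurable_pi_lambda _ fun _ => Finset.measurable_fun_sum _ fun i _ => measurable_pi_apply i

theorem measurable_edgeMarginal (u w : V) :
    Measurable fun q : (∀ v, I v) → ℝ => edgeMarginal q u w :=
  measurable_pi_lambda _ fun _ => Finset.measurable_fun_sum _ fun i _ => measurable_pi_apply i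

theorem measurable_condProb (w : V) (D : Finset V) (k : ∀ u : D, I u) :
    Measurable fun q : (∀ v, I v) → ℝ => condProb q w D k :=
  measurable_pi_lambda _ fun _ =>
    (Finset.measurable_fun_sum _ fun i _ => measurable_pi_apply i).div (measurable_marginal D k)

section RootedFactorization

variable {G : SimpleGraph V} [DecidableRel G.Adj]

/-- A table that factorizes over the cliques of a tree is the product of the conditional probabilities
along the edges directed away from a root. -/
theorem eq_prod_condProb [Nontrivial V] (hG : G.IsTree) {K : ℕ} {C : Fin K → Finset V}
    (hC : IsPerfectOrder G C) (r : V) {q : (∀ v, I v) → ℝ} (hq : ∀ i, 0 < q i) (i : ∀ v, I v)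
    (h : q i = (∏ l, marginal q (C l) ((C l).restrict i)) /
      ∏ l, marginal q (separator C l) ((separator C l).restrict i)) :
    q i = ∏ w, condProb q w (rootedParents G r w) ((rootedParents G r w).restrict i) (i w) := by
  have : Nonempty (∀ v, I v) := ⟨i⟩
  rw [h, hC.prod_div_prod_separator hG r (fun D => marginal q D (D.restrict i))
    fun D => (marginal_pos hq D _).ne']
  refine Finset.prod_congr rfl fun w _ => ?_
  rw [condProb_eq q (notMem_rootedParents_self r w)]
  congr 2
  rw [restrict_eq_consCell_iff]
  exact ⟨rfl, rfl⟩

/-- A monomial in the entries of such a table is a monomial in the conditional probabilities. -/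
theorem prod_pow_eq_prod_condProb [Nontrivial V] (hG : G.IsTree) {K : ℕ} {C : Fin K → Finset V}
    (hC : IsPerfectOrder G C) (ρ : V) {q : (∀ v, I v) → ℝ} (hq : ∀ i, 0 < q i)
    (h : ∀ i, q i = (∏ l, marginal q (C l) ((C l).restrict i)) /
      ∏ l, marginal q (separator C l) ((separator C l).restrict i)) (r : (∀ v, I v) → ℕ) :
    ∏ i, q i ^ r i = ∏ x : Σ w : V, (∀ u : rootedParents G ρ w, I u), ∏ l,
      condProb q x.1 (rootedParents G ρ x.1) x.2 l ^
        marginal r (insert x.1 (rootedParents G ρ x.1))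
          (consCell (notMem_rootedParents_self ρ x.1) (x.2, l)) := by
  rw [Fintype.prod_sigma]
  simp only
  have h1 : ∀ w, ∏ k, ∏ l, condProb q w (rootedParents G ρ w) k l ^
        marginal r (insert w (rootedParents G ρ w))
          (consCell (notMem_rootedParents_self ρ w) (k, l)) =
      ∏ i, condProb q w (rootedParents G ρ w) ((rootedParents G ρ w).restrict i) (i w) ^ r i := by
    intro w
    set e := consCell (I := I) (notMem_rootedParents_self (G := G) ρ w) with he
    have h2 := prod_pow_marginal r (insert w (rootedParents G ρ w))
      fun c => condProb q w (rootedParents G ρ w) (e.symm c).1 (e.symm c).2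
    rw [← Equiv.prod_comp e, Fintype.prod_prod_type] at h2
    simp only [Equiv.symm_apply_apply] at h2
    exact h2.symm
  rw [Finset.prod_congr rfl fun w _ => h1 w, Finset.prod_comm]
  refine Finset.prod_congr rfl fun i _ => ?_
  rw [Finset.prod_pow, ← eq_prod_condProb hG hC ρ hq i (h i)]

end RootedFactorization

end Marginals

/-! ### Independence and products of moments -/

section Independence

theorem integral_mul_of_indep {Ω : Type*} {m₁ m₂ mΩ : MeasurableSpace Ω} {μ : Measure Ω}
    (hind : Indep m₁ m₂ μ) (h₁ : m₁ ≤ mΩ) (h₂ : m₂ ≤ mΩ) {f g : Ω → ℝ} (hf : Measurable[m₁] f)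
    (hg : Measurable[m₂] g) : ∫ ω, f ω * g ω ∂μ = (∫ ω, f ω ∂μ) * ∫ ω, g ω ∂μ := by
  have h : IndepFun f g μ := by
    rw [IndepFun_iff_Indep]
    exact indep_of_indep_of_le_left (indep_of_indep_of_le_right hind hg.comap_le) hf.comap_le
  exact h.integral_mul_eq_mul_integral (hf.mono h₁ le_rfl).aestronglyMeasurable
    (hg.mono h₂ le_rfl).aestronglyMeasurable

theorem measurable_sum_mul {Ω : Type*} [MeasurableSpace Ω] {T : Type*} [Fintype T]
    {f g : T → Ω → ℝ} (hf : ∀ t, Measurable (f t)) (hg : ∀ t, Measurable (g t)) :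
    Measurable fun ω => ∑ t, f t ω * g t ω :=
  Finset.measurable_fun_sum _ fun t _ => (hf t).mul (hg t)

theorem measurable_prod_pow {Ω : Type*} [MeasurableSpace Ω] {T : Type*} [Fintype T]
    {f : T → Ω → ℝ} (hf : ∀ t, Measurable (f t)) (n : T → ℕ) :
    Measurable fun ω => ∏ t, f t ω ^ n t :=
  Finset.measurable_fun_prod _ fun t _ => (hf t).pow_const _

theorem integral_prod_prod_pow {Ω ι : Type*} [MeasurableSpace Ω] {μ : Measure Ω} [Fintype ι]
    {T : ι → Type*} [∀ x, Fintype (T x)] {X : ∀ x, Ω → T x → ℝ} (hind : iIndepFun X μ)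
    (hX : ∀ x, Measurable (X x)) (n : ∀ x, T x → ℕ) :
    ∫ ω, ∏ x, ∏ t, X x ω t ^ n x t ∂μ = ∏ x, moment μ (X x) (n x) :=
  hind.integral_fun_prod_comp (𝕜 := ℝ) (f := fun x v => ∏ t, v t ^ n x t)
    (fun x => (hX x).aemeasurable) fun x => (measurable_prod_pow
      (f := fun t (v : T x → ℝ) => v t) (fun t => measurable_pi_apply t) (n x)).aestronglyMeasurable

/-- The σ-algebra generated by the random vectors `θ x` with `x ∈ S`. -/
abbrev generatedBy {Ω ι : Type*} {β : ι → Type*} [∀ x, MeasurableSpace (β x)] (θ : ∀ x, Ω → β x)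
    (S : Set ι) : MeasurableSpace Ω :=
  ⨆ x ∈ S, MeasurableSpace.comap (θ x) inferInstance

theorem measurable_generatedBy {Ω ι : Type*} {β : ι → Type*} [∀ x, MeasurableSpace (β x)]
    (θ : ∀ x, Ω → β x) {S : Set ι} {x : ι} (hx : x ∈ S) : Measurable[generatedBy θ S] (θ x) := by
  rw [measurable_iff_comap_le]
  exact le_biSup (fun x => MeasurableSpace.comap (θ x) inferInstance) hx

theorem generatedBy_le {Ω ι : Type*} [mΩ : MeasurableSpace Ω] {β : ι → Type*}
    [∀ x, MeasurableSpace (β x)] {θ : ∀ x, Ω → β x} (hθ : ∀ x, Measurable (θ x)) (S : Set ι) :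
    generatedBy θ S ≤ mΩ :=
  iSup₂_le fun x _ => (hθ x).comap_le

end Independence

/-! ### Edge and vertex marginals under parameter independence -/

variable {V : Type*} [Fintype V] [DecidableEq V]
variable {I : V → Type*} [∀ v, Fintype (I v)] [∀ v, DecidableEq (I v)]
variable {Ω : Type*} [MeasurableSpace Ω] {μ : Measure Ω} {p : Ω → (∀ v, I v) → ℝ}

/-- The conditional distribution at `w` given the value `k` at `u`. -/
noncomputable def edgeRow (q : (∀ v, I v) → ℝ) (u w : V) (k : I u) (l : I w) : ℝ :=
  edgeMarginal q u w (k, l) / vertexMarginal q u k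

theorem condProb_singletonCell (q : (∀ v, I v) → ℝ) {u w : V} (hw : w ∉ ({u} : Finset V))
    (k : I u) : condProb q w {u} (singletonCell u k) = edgeRow q u w k := by
  ext l
  rw [condProb_eq q hw, marginal_singleton, marginal_consCell_singleton]
  rfl

namespace IsRandomProbabilities

theorem nonempty [NeZero μ] (hp : IsRandomProbabilities μ p) : Nonempty (∀ v, I v) := by
  by_contra h
  rw [not_nonempty_iff] at h
  obtain ⟨ω, hω⟩ := hp.sum_eq_one.exists
  simp at hω

variable [IsProbabilityMeasure μ]

theorem vertexMarginal (hp : IsRandomProbabilities μ p) (u : V) :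
    IsRandomSimplex μ fun ω => vertexMarginal (p ω) u where
  measurable := (measurable_vertexMarginal u).comp hp.measurable
  pos := by
    have := hp.nonempty
    filter_upwards [hp.pos] with ω h using vertexMarginal_pos h u
  sum_eq_one := by
    filter_upwards [hp.sum_eq_one] with ω h
    rw [sum_vertexMarginal, h]

theorem edgeMarginal (hp : IsRandomProbabilities μ p) {u w : V} (huw : u ≠ w) :
    IsRandomSimplex μ fun ω => edgeMarginal (p ω) u w where
  measurable := (measurable_edgeMarginal u w).comp hp.measurable
  pos := by
    have := hp.nonempty
    filter_upwards [hp.pos] with ω h using edgeMarginal_pos h huw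
  sum_eq_one := by
    filter_upwards [hp.sum_eq_one] with ω h
    rw [Fintype.sum_prod_type]
    simp only [sum_edgeMarginal]
    rw [sum_vertexMarginal, h]

theorem edgeRow (hp : IsRandomProbabilities μ p) {u w : V} (huw : u ≠ w) (k : I u) :
    IsRandomSimplex μ fun ω => edgeRow (p ω) u w k where
  measurable := measurable_pi_lambda _ fun l =>
    (measurable_pi_iff.1 (hp.edgeMarginal huw).measurable (k, l)).div
      (measurable_pi_iff.1 (hp.vertexMarginal u).measurable k)
  pos := by
    filter_upwards [(hp.edgeMarginal huw).pos, (hp.vertexMarginal u).pos] with ω h1 h2 l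
    exact div_pos (h1 _) (h2 _)
  sum_eq_one := by
    filter_upwards [(hp.vertexMarginal u).pos] with ω h
    simp only [GraphDirichlet.edgeRow]
    rw [← Finset.sum_div, sum_edgeMarginal, div_self (h k).ne']

variable {G : SimpleGraph V} [DecidableRel G.Adj]

/-- Up to null sets, the marginal at a vertex is a function of the parameters at the vertices
that are not farther away from the root. -/
theorem exists_measurable_vertexMarginal (hp : IsRandomProbabilities μ p) (hG : G.IsTree) (r : V)
    (N : ℕ) (y : V) (hy : G.dist r y < N) (l : I y) :
    ∃ f : Ω → ℝ, Measurable[generatedBy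
      (fun (x : Σ v : V, (∀ u : rootedParents G r v, I u)) (ω : Ω) (l : I x.1) =>
        condProb (p ω) x.1 (rootedParents G r x.1) x.2 l) {x | G.dist r x.1 < N}] f ∧
      (fun ω => GraphDirichlet.vertexMarginal (p ω) y l) =ᵐ[μ] f := by
  have hne := hp.nonempty
  induction hd : G.dist r y using Nat.strong_induction_on generalizing y with
  | _ d ih =>
  have hcell : ∀ k : ∀ u : rootedParents G r y, I u, ∃ f : Ω → ℝ, Measurable[generatedBy
      (fun (x : Σ v : V, (∀ u : rootedParents G r v, I u)) (ω : Ω) (l : I x.1) =>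
        condProb (p ω) x.1 (rootedParents G r x.1) x.2 l) {x | G.dist r x.1 < N}] f ∧
      (fun ω => marginal (p ω) (rootedParents G r y) k) =ᵐ[μ] f := by
    rcases eq_or_ne y r with rfl | hyr
    · rw [rootedParents_self]
      intro k
      refine ⟨fun _ => 1, measurable_const, ?_⟩
      filter_upwards [hp.sum_eq_one] with ω h
      rw [marginal_empty, h]
    · obtain ⟨z, hz⟩ := exists_rootedParents_eq_singleton hG hyr
      have hzd := (mem_rootedParents.1 (hz ▸ Finset.mem_singleton_self z :
        z ∈ rootedParents G r y)).2
      rw [hz]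
      intro k
      obtain ⟨f, hf, h⟩ := ih (G.dist r z) (by omega) z (by omega)
        (k ⟨z, Finset.mem_singleton_self z⟩) rfl
      refine ⟨f, hf, ?_⟩
      simpa only [marginal_singleton] using h
  choose f hf hfe using hcell
  -- Law of total probability: the marginal at `y` combines that of its parent, known by induction,
  -- with the parameters at `y`. At the root the marginal of the empty set is `1`.
  refine ⟨fun ω => ∑ k, f k ω * condProb (p ω) y (rootedParents G r y) k l,
    @measurable_sum_mul _ (_) _ _ _ _ hf fun k => ?_, ?_⟩
  · have h := measurable_generatedBy
      (fun (x : Σ v : V, (∀ u : rootedParents G r v, I u)) (ω : Ω) (l : I x.1) =>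
        condProb (p ω) x.1 (rootedParents G r x.1) x.2 l) (S := {x | G.dist r x.1 < N})
      (x := ⟨y, k⟩) hy
    exact (measurable_pi_apply l).comp h
  · have h := ae_all_iff.2 hfe
    filter_upwards [h, hp.pos] with ω h1 h2
    rw [← sum_marginal_mul_condProb (p ω) (fun k => (marginal_pos h2 (rootedParents G r y) k).ne') l]
    simp only [← h1]

/-- Under parameter independence along an edge, the moments of the edge marginal factorize. -/
theorem isRowFactorization (hp : IsRandomProbabilities μ p) (hG : G.IsTree) {r u w : V}
    (hD : rootedParents G r w = {u})
    (hind : iIndepFun (fun (x : Σ v : V, (∀ u : rootedParents G r v, I u)) (ω : Ω) (l : I x.1) =>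
      condProb (p ω) x.1 (rootedParents G r x.1) x.2 l) μ) :
    IsRowFactorization (moment μ fun ω => GraphDirichlet.edgeMarginal (p ω) u w)
      (moment μ fun ω => GraphDirichlet.vertexMarginal (p ω) u)
      (fun k => moment μ fun ω => GraphDirichlet.edgeRow (p ω) u w k) := by
  have hu := mem_rootedParents.1 (hD ▸ Finset.mem_singleton_self u : u ∈ rootedParents G r w)
  have huw : u ≠ w := hu.1.ne
  refine ⟨IsRandomSimplex.moment_zero, fun _ => IsRandomSimplex.moment_zero,
    (hp.vertexMarginal u).moment_pos, fun k => (hp.edgeRow huw k).moment_pos, fun ρ => ?_,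
    (hp.vertexMarginal u).sum_moment_add_units, fun k => (hp.edgeRow huw k).sum_moment_add_units⟩
  set θ := fun (x : Σ v : V, (∀ u : rootedParents G r v, I u)) (ω : Ω) (l : I x.1) =>
      condProb (p ω) x.1 (rootedParents G r x.1) x.2 l with hθ
  have hθm : ∀ x, Measurable (θ x) := fun x => (measurable_condProb _ _ _).comp hp.measurable
  -- The index type of the parameters depends on the parent set, so the equality with `{u}` is used
  -- through an equivalence of cells.
  obtain ⟨e, he⟩ : ∃ e : I u ≃ (∀ x : rootedParents G r w, I x), ∀ k ω,
      θ ⟨w, e k⟩ ω = GraphDirichlet.edgeRow (p ω) u w k := by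
    have hw : w ∉ ({u} : Finset V) := by simpa using huw.symm
    simp only [hθ]
    generalize rootedParents G r w = D at hD
    subst hD
    exact ⟨singletonCell u, fun k ω => condProb_singletonCell (p ω) hw k⟩
  choose f hf hfe using fun k => hp.exists_measurable_vertexMarginal hG r (G.dist r w) u (by omega) k
  have hfe' := ae_all_iff.2 hfe
  have hrow : ∫ ω, ∏ k, ∏ l, θ ⟨w, e k⟩ ω l ^ ρ (k, l) ∂μ =
      ∏ k, moment μ (fun ω => GraphDirichlet.edgeRow (p ω) u w k) fun l => ρ (k, l) := by
    have hinj : Function.Injective fun k => (⟨w, e k⟩ : Σ v : V, (∀ u : rootedParents G r v, I u)) :=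
      fun a b hab => e.injective (by simpa using hab)
    have h1 := integral_prod_prod_pow (hind.precomp hinj) (fun k => hθm _) fun k l => ρ (k, l)
    refine h1.trans (Finset.prod_congr rfl fun k _ => ?_)
    simp only [moment, ← he]
  -- Parameters at vertices strictly closer to the root than `w` and parameters at `w` form disjoint
  -- families.
  have hS : Indep (generatedBy θ {x | G.dist r x.1 < G.dist r w}) (generatedBy θ {x | x.1 = w}) μ := by
    refine indep_iSup_of_disjoint (fun x => (hθm x).comap_le) hind.iIndep ?_
    rw [Set.disjoint_left]
    rintro x hx rfl
    exact lt_irrefl _ (show G.dist r x.1 < G.dist r x.1 from hx)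
  have hmul := integral_mul_of_indep hS (generatedBy_le hθm _) (generatedBy_le hθm _)
    (f := fun ω => ∏ k, f k ω ^ ∑ l, ρ (k, l))
    (g := fun ω => ∏ k, ∏ l, θ ⟨w, e k⟩ ω l ^ ρ (k, l))
    (@measurable_prod_pow _ (_) _ _ _ hf _) ?_
  · rw [hrow] at hmul
    have h1 : ∫ ω, ∏ k, f k ω ^ ∑ l, ρ (k, l) ∂μ =
        moment μ (fun ω => GraphDirichlet.vertexMarginal (p ω) u) fun k => ∑ l, ρ (k, l) := by
      refine integral_congr_ae ?_
      filter_upwards [hfe'] with ω h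
      simp only [h]
    rw [h1] at hmul
    rw [← hmul]
    refine integral_congr_ae ?_
    filter_upwards [hfe', (hp.vertexMarginal u).pos] with ω h hpos
    simp only [← h, he]
    rw [Fintype.prod_prod_type, ← Finset.prod_mul_distrib]
    refine Finset.prod_congr rfl fun k _ => ?_
    rw [← Finset.prod_pow_eq_pow_sum, ← Finset.prod_mul_distrib]
    refine Finset.prod_congr rfl fun l _ => ?_
    rw [← mul_pow, GraphDirichlet.edgeRow, mul_div_cancel₀ _ (hpos k).ne']
  · have h1 : ∀ k, Measurable[generatedBy θ {x | x.1 = w}] (θ ⟨w, e k⟩) := fun k =>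
      measurable_generatedBy θ rfl
    have h2 := @measurable_prod_pow _ (generatedBy θ {x | x.1 = w}) (I u × I w) _
      (fun a ω => θ ⟨w, e a.1⟩ ω a.2) (fun a => (measurable_pi_apply a.2).comp (h1 a.1)) ρ
    simpa only [Fintype.prod_prod_type] using h2

end IsRandomProbabilities

/-- The recursion of Dirichlet moments, with inverse total mass `κ`, for the marginal at `u`. -/
def VertexRecursion (μ : Measure Ω) (p : Ω → (∀ v, I v) → ℝ) (κ : ℝ) (u : V) : Prop :=
  ∀ n k, moment μ (fun ω => vertexMarginal (p ω) u) (n + units k 1) *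
      (1 + κ * ∑ t, (n t : ℝ)) =
    moment μ (fun ω => vertexMarginal (p ω) u) n *
      (moment μ (fun ω => vertexMarginal (p ω) u) (units k 1) + κ * n k)

/-- The recursion of Dirichlet moments, with inverse total mass `κ` of the edge marginal,
for the conditional distributions along an edge. -/
def EdgeRecursion (μ : Measure Ω) (p : Ω → (∀ v, I v) → ℝ) (κ : ℝ) (u w : V) : Prop :=
  ∀ k m l, moment μ (fun ω => edgeRow (p ω) u w k) (m + units l 1) *
      (moment μ (fun ω => vertexMarginal (p ω) u) (units k 1) + κ * ∑ t, (m t : ℝ)) =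
    moment μ (fun ω => edgeRow (p ω) u w k) m *
      (moment μ (fun ω => edgeMarginal (p ω) u w) (units (k, l) 1) + κ * m l)

variable {G : SimpleGraph V} [DecidableRel G.Adj]

theorem ParameterIndependence.not_ae_const {r u w : V}
    (hD : rootedParents G r w = {u}) (h : ParameterIndependence μ p (rootedParents G r)) (k : I u) :
    ¬ ∃ c : I w → ℝ, ∀ᵐ ω ∂μ, edgeRow (p ω) u w k = c := by
  have hw : w ∉ ({u} : Finset V) := hD ▸ notMem_rootedParents_self r w
  have h1 := h.2 w
  rw [hD] at h1
  simpa only [condProb_singletonCell _ hw] using h1 (singletonCell u k)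

variable [IsProbabilityMeasure μ]

theorem moment_edgeMarginal_swap (u w : V) (ρ : I u × I w → ℕ) :
    moment μ (fun ω => edgeMarginal (p ω) w u) (ρ ∘ Prod.swap) =
      moment μ (fun ω => edgeMarginal (p ω) u w) ρ := by
  unfold moment
  congr 1
  ext ω
  rw [← Equiv.prod_comp (Equiv.prodComm (I u) (I w))]
  simp [edgeMarginal_swap]

/-- One leaf behind each end of the edge supplies the row and the column factorization of the same
table. Nontriviality of `I u` comes from the opposite orientation, where `u` is the child. -/
theorem exists_edge_recursion (hp : IsRandomProbabilities μ p) (hG : G.IsTree)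
    (hind : ∀ v, G.degree v = 1 → ParameterIndependence μ p (rootedParents G v)) {u w : V}
    (h : G.Adj u w) :
    Nontrivial (I u) ∧ ∃ κ : ℝ, 0 < κ ∧ VertexRecursion μ p κ u ∧ VertexRecursion μ p κ w ∧
      EdgeRecursion μ p κ u w := by
  have hne := hp.nonempty
  obtain ⟨r, hr, hD⟩ := exists_leaf_rootedParents_eq hG h
  obtain ⟨r', hr', hD'⟩ := exists_leaf_rootedParents_eq hG h.symm
  have k₀ : ∀ v, I v := Classical.arbitrary _
  -- Over a one-point set the conditional distribution is constantly `1`, which non-degeneracy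
  -- forbids.
  have hnt : ∀ {r u w}, rootedParents G r w = {u} → G.degree r = 1 → u ≠ w → Nontrivial (I w) := by
    intro r u w hD hr huw
    by_contra hns
    rw [not_nontrivial_iff_subsingleton] at hns
    refine (hind r hr).not_ae_const hD (k₀ u) ⟨fun _ => 1, ?_⟩
    filter_upwards [(hp.edgeRow huw (k₀ u)).sum_eq_one] with ω hω
    ext l
    rwa [Fintype.sum_eq_single l fun b hb => absurd (Subsingleton.elim b l) hb] at hω
  have hIw := hnt hD hr h.ne
  have hIu := hnt hD' hr' h.ne.symm
  have F := hp.isRowFactorization hG hD (hind r hr).1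
  have F' := hp.isRowFactorization hG hD' (hind r' hr').1
  have hswap : moment μ (fun ω => edgeMarginal (p ω) w u) =
      fun ρ => moment μ (fun ω => edgeMarginal (p ω) u w) (ρ ∘ Prod.swap) := by
    ext ρ
    rw [← moment_edgeMarginal_swap]
  rw [hswap] at F'
  obtain ⟨κ, hκ, H⟩ := F.exists_affine F'
  have R := F.right_recursion hκ H
  refine ⟨hIu, κ, lt_of_le_of_ne hκ ?_, F.left_recursion H, ?_, R⟩
  -- With `κ = 0` the recursion makes second moments of the row equal to squared first moments, so
  -- the row would be almost surely constant.
  · rintro rfl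
    refine (hind r hr).not_ae_const hD (k₀ u)
      ⟨fun l => moment μ (fun ω => edgeRow (p ω) u w (k₀ u)) (units l 1), ?_⟩
    have hX := hp.edgeRow h.ne (k₀ u)
    have hpos := F.pos_left (units (k₀ u) 1)
    have h1 : ∀ l, ∀ᵐ ω ∂μ, edgeRow (p ω) u w (k₀ u) l =
        moment μ (fun ω => edgeRow (p ω) u w (k₀ u)) (units l 1) := by
      intro l
      refine hX.ae_eq_const_of_moment ?_
      have e1 := R (k₀ u) 0 l
      have e2 := R (k₀ u) (units l 1) l
      simp only [zero_mul, add_zero, zero_add, F.right_zero, one_mul] at e1 e2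
      rw [← e1] at e2
      refine mul_right_cancel₀ hpos.ne' ?_
      linear_combination e2
    filter_upwards [ae_all_iff.2 h1] with ω hω
    ext l
    exact hω l
  · exact F'.left_recursion (IsRowFactorization.swap_affine H)

/-- With `a` and `b` the first and second moments of one entry, `b * (1 + κ) = a * (a + κ)`
determines `κ` unless `b = a`. That case would force `a = 0` or `a = 1`, impossible for a positive
vector with two entries summing to one. -/
theorem VertexRecursion.unique (hp : IsRandomProbabilities μ p) {u : V} [Nontrivial (I u)] {κ κ' : ℝ}
    (h : VertexRecursion μ p κ u) (h' : VertexRecursion μ p κ' u) : κ = κ' := by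
  have hX := hp.vertexMarginal u
  obtain ⟨k, k', hk⟩ := exists_pair_ne (I u)
  have h1 := h (units k 1) k
  have h2 := h' (units k 1) k
  have hs : ∑ t, (units k 1 t : ℝ) = 1 := by
    rw [← Nat.cast_sum]
    simp
  simp only [hs, Pi.single_eq_same, Nat.cast_one, mul_one] at h1 h2
  have hlt : moment μ (fun ω => vertexMarginal (p ω) u) (units k 1) < 1 := by
    have h3 := hX.sum_moment_add_units 0
    rw [IsRandomSimplex.moment_zero] at h3
    simp only [zero_add] at h3
    rw [← h3]
    exact Finset.single_lt_sum
      (f := fun t => moment μ (fun ω => vertexMarginal (p ω) u) (units t 1)) hk.symm (Finset.mem_univ _) (Finset.mem_univ _) (hX.moment_pos _)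
      fun t _ _ => (hX.moment_pos _).le
  have hpos := hX.moment_pos (units k 1)
  set a := moment μ (fun ω => vertexMarginal (p ω) u) (units k 1)
  set b := moment μ (fun ω => vertexMarginal (p ω) u) (units k 1 + units k 1)
  have h3 : (κ - κ') * (b - a) = 0 := by linear_combination h1 - h2
  rcases mul_eq_zero.1 h3 with h4 | h4
  · linarith
  · have h5 : b = a := by linarith
    rw [h5] at h1
    have h6 : a * (1 - a) = 0 := by linear_combination h1
    rcases mul_eq_zero.1 h6 with h7 | h7 <;> linarith

/-- All the vertex and edge marginals are Dirichlet with the same total mass. -/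
theorem exists_recursion [Nontrivial V] (hp : IsRandomProbabilities μ p) (hG : G.IsTree)
    (hind : ∀ v, G.degree v = 1 → ParameterIndependence μ p (rootedParents G v)) :
    ∃ κ : ℝ, 0 < κ ∧ (∀ u, VertexRecursion μ p κ u) ∧
      ∀ u w, G.Adj u w → EdgeRecursion μ p κ u w := by
  obtain ⟨v₀⟩ := hG.connected.nonempty
  obtain ⟨w₀, h₀⟩ := hG.connected.preconnected.exists_adj_of_nontrivial v₀
  obtain ⟨_, κ, hκ, hv₀, -, -⟩ := exists_edge_recursion hp hG hind h₀
  -- The induction on the walk moves `v₀`; an adjacency with the fixed `w₀` must not enter its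
  -- hypothesis.
  clear h₀
  have hV : ∀ u, VertexRecursion μ p κ u := by
    intro u
    obtain ⟨q⟩ := hG.connected v₀ u
    induction q with
    | nil => exact hv₀
    | cons hadj _ ih =>
      obtain ⟨_, κ', -, h1, h2, -⟩ := exists_edge_recursion hp hG hind hadj
      obtain rfl := hv₀.unique hp h1
      obtain ⟨_, -⟩ := exists_edge_recursion hp hG hind hadj.symm
      exact ih inferInstance h2
  refine ⟨κ, hκ, hV, fun u w h => ?_⟩
  obtain ⟨_, κ', -, h1, -, h2⟩ := exists_edge_recursion hp hG hind h
  obtain rfl := (hV u).unique hp h1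
  exact h2

/-! ### Moments of the conditional and of the cell probabilities -/

namespace IsRandomProbabilities

theorem integrable_marginal (hp : IsRandomProbabilities μ p) (D : Finset V) (k : ∀ u : D, I u) :
    Integrable (fun ω => marginal (p ω) D k) μ := by
  refine Integrable.of_bound
    ((measurable_marginal D k).comp hp.measurable).aestronglyMeasurable 1 ?_
  filter_upwards [hp.pos, hp.sum_eq_one] with ω h1 h2
  have h3 : 0 ≤ marginal (p ω) D k := Finset.sum_nonneg fun i _ => (h1 i).le
  rw [Real.norm_of_nonneg h3, ← h2]
  exact Finset.sum_le_sum_of_subset_of_nonneg (Finset.subset_univ _) fun i _ _ => (h1 i).le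

theorem integral_marginal_pos (hp : IsRandomProbabilities μ p) (D : Finset V) (k : ∀ u : D, I u) :
    0 < ∫ ω, marginal (p ω) D k ∂μ := by
  have hne := hp.nonempty
  have h0 : ∀ᵐ ω ∂μ, 0 < marginal (p ω) D k := by
    filter_upwards [hp.pos] with ω h using marginal_pos h D k
  refine lt_of_le_of_ne (integral_nonneg_of_ae (h0.mono fun ω h => h.le)) fun h => ?_
  have h1 := (integral_eq_zero_iff_of_nonneg_ae (h0.mono fun ω h => h.le)
    (hp.integrable_marginal D k)).1 h.symm
  obtain ⟨ω, h2, h3⟩ := (h0.and h1).exists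
  exact h2.ne' h3

/-- Vertex recursions (at the root, with expected mass one) and edge recursions take a common form
in terms of expected marginals. Division by `κ` turns it into the hypothesis of
`eq_gamma_of_recursion`. -/
theorem moment_condProb_add_units (hp : IsRandomProbabilities μ p) {κ : ℝ}
    (hV : ∀ u, VertexRecursion μ p κ u) (hE : ∀ u w, G.Adj u w → EdgeRecursion μ p κ u w) {w : V}
    {D : Finset V} (hw : w ∉ D) (hD : D = ∅ ∨ ∃ u, G.Adj u w ∧ D = {u}) (k : ∀ u : D, I u)
    (n : I w → ℕ) (l : I w) :
    moment μ (fun ω => condProb (p ω) w D k) (n + units l 1) *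
        (∫ ω, marginal (p ω) D k ∂μ + κ * ∑ t, (n t : ℝ)) =
      moment μ (fun ω => condProb (p ω) w D k) n *
        (∫ ω, marginal (p ω) (insert w D) (consCell hw (k, l)) ∂μ + κ * n l) := by
  obtain rfl | ⟨u, hadj, rfl⟩ := hD
  · have h1 : ∀ n, moment μ (fun ω => condProb (p ω) w ∅ k) n =
        moment μ (fun ω => GraphDirichlet.vertexMarginal (p ω) w) n := by
      refine moment_congr ?_
      filter_upwards [hp.sum_eq_one] with ω h l
      rw [condProb_eq _ hw, marginal_empty, marginal_consCell_empty, h, div_one]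
    have h2 : ∫ ω, marginal (p ω) ∅ k ∂μ = 1 := by
      have : ∫ ω, marginal (p ω) ∅ k ∂μ = ∫ _, (1 : ℝ) ∂μ := by
        refine integral_congr_ae ?_
        filter_upwards [hp.sum_eq_one] with ω h
        rw [marginal_empty, h]
      simp [this]
    simp only [marginal_consCell_empty, h1, h2]
    rw [← IsRandomSimplex.moment_units (X := fun ω => GraphDirichlet.vertexMarginal (p ω) w)]
    exact hV w n l
  · obtain ⟨k, rfl⟩ := (singletonCell u).surjective k
    simp only [condProb_singletonCell _ hw, marginal_singleton, marginal_consCell_singleton]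
    have h1 := hE u w hadj k n l
    rw [IsRandomSimplex.moment_units, IsRandomSimplex.moment_units] at h1
    exact h1

/-- The moments of the parameters of a hyper Dirichlet distribution. -/
theorem moment_condProb_eq (hp : IsRandomProbabilities μ p) (hG : G.IsTree) {κ : ℝ} (hκ : 0 < κ)
    (hV : ∀ u, VertexRecursion μ p κ u) (hE : ∀ u w, G.Adj u w → EdgeRecursion μ p κ u w)
    {α : ∀ D : Finset V, (∀ u : D, I u) → ℝ}
    (hα : ∀ D k, α D k = κ⁻¹ * ∫ ω, marginal (p ω) D k ∂μ) (r w : V)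
    (k : ∀ u : rootedParents G r w, I u) (n : I w → ℕ) :
    moment μ (fun ω => condProb (p ω) w (rootedParents G r w) k) n =
      (∏ l, Real.Gamma (α _ (consCell (notMem_rootedParents_self r w) (k, l)) + n l) /
        Real.Gamma (α _ (consCell (notMem_rootedParents_self r w) (k, l)))) /
      (Real.Gamma (α _ k + ∑ l, (n l : ℝ)) / Real.Gamma (α _ k)) := by
  have hpos : ∀ D k, 0 < α D k := fun D k => by
    rw [hα]
    exact mul_pos (inv_pos.2 hκ) (hp.integral_marginal_pos D k)
  refine eq_gamma_of_recursion _ (fun l => α _ (consCell (notMem_rootedParents_self r w) (k, l)))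
    (fun l => hpos _ _) (hpos _ _) IsRandomSimplex.moment_zero (fun n l => ?_) n
  have hD : rootedParents G r w = ∅ ∨ ∃ u, G.Adj u w ∧ rootedParents G r w = {u} := by
    rcases eq_or_ne w r with rfl | hwr
    · exact Or.inl (rootedParents_self w)
    · obtain ⟨u, hu⟩ := exists_rootedParents_eq_singleton hG hwr
      exact Or.inr ⟨u, (mem_rootedParents.1 (hu ▸ Finset.mem_singleton_self u :
        u ∈ rootedParents G r w)).1, hu⟩
  have h := hp.moment_condProb_add_units hV hE (notMem_rootedParents_self r w) hD k n l
  simp only [hα]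
  field_simp
  linear_combination h

/-- The moments of the cell probabilities, as products over the vertices. -/
theorem integral_prod_pow_eq [Nontrivial V] (hp : IsRandomProbabilities μ p) (hG : G.IsTree)
    {K : ℕ} {C : Fin K → Finset V} (hC : IsPerfectOrder G C)
    (hassoc : ∀ᵐ ω ∂μ, ∀ i : ∀ v, I v,
      p ω i = (∏ l, marginal (p ω) (C l) ((C l).restrict i)) /
        ∏ l, marginal (p ω) (separator C l) ((separator C l).restrict i)) (ρ : V)
    (hind : iIndepFun (fun (x : Σ v : V, (∀ u : rootedParents G ρ v, I u)) (ω : Ω) (l : I x.1) =>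
      condProb (p ω) x.1 (rootedParents G ρ x.1) x.2 l) μ) (r : (∀ v, I v) → ℕ) :
    ∫ ω, ∏ i, p ω i ^ r i ∂μ = ∏ w, ∏ k,
      moment μ (fun ω => condProb (p ω) w (rootedParents G ρ w) k) fun l =>
        marginal r (insert w (rootedParents G ρ w))
          (consCell (notMem_rootedParents_self ρ w) (k, l)) := by
  have h1 := integral_prod_prod_pow hind
    (fun x => (measurable_condProb _ _ _).comp hp.measurable) fun x l =>
      marginal r (insert x.1 (rootedParents G ρ x.1))
        (consCell (notMem_rootedParents_self ρ x.1) (x.2, l))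
  refine (integral_congr_ae ?_).trans (h1.trans ?_)
  rotate_left
  · rw [Fintype.prod_sigma]
  filter_upwards [hp.pos, hassoc] with ω h2 h3
  exact prod_pow_eq_prod_condProb hG hC ρ h2 h3 r

end IsRandomProbabilities

theorem normConst_div_normConst {K : ℕ} (C : Fin K → Finset V)
    (α β : ∀ D : Finset V, (∀ u : D, I u) → ℝ) :
    normConst C β / normConst C α =
      (∏ l, ∏ k, Real.Gamma (β (C l) k) / Real.Gamma (α (C l) k)) /
        ∏ l, ∏ k, Real.Gamma (β (separator C l) k) / Real.Gamma (α (separator C l) k) := by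
  simp only [normConst, Finset.prod_div_distrib]
  rw [div_div_div_eq, div_div_div_eq, mul_comm (∏ l, ∏ k, Real.Gamma (β (separator C l) k))]

end GraphDirichlet

theorem mainTheorem6 {V : Type*} [Fintype V] [DecidableEq V]
    (hV : 2 ≤ Fintype.card V)
    (G : SimpleGraph V) [DecidableRel G.Adj] (hG : G.IsTree)
    {I : V → Type*} [∀ v, Fintype (I v)] [∀ v, DecidableEq (I v)]
    {Ω : Type*} [MeasurableSpace Ω] (μ : MeasureTheory.Measure Ω)
    [MeasureTheory.IsProbabilityMeasure μ]
    (p : Ω → (∀ v, I v) → ℝ)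
    (hp : GraphDirichlet.IsAssociated G μ p)
    (hind : ∀ v : V, G.degree v = 1 →
      GraphDirichlet.ParameterIndependence μ p (GraphDirichlet.rootedParents G v)) :
    GraphDirichlet.FollowsHyperDirichlet G μ p := by
  open GraphDirichlet in
  have hnt : Nontrivial V := Fintype.one_lt_card_iff_nontrivial.1 hV
  obtain ⟨hp₁, K, C, hC, hassoc⟩ := id hp
  obtain ⟨κ, hκ, hVR, hER⟩ := exists_recursion hp₁ hG hind
  -- One leaf suffices from here on: the recursions no longer refer to a root, and independence is
  -- needed only to multiply moments.
  obtain ⟨ρ, hρ⟩ := hG.exists_vert_degree_one_of_nontrivial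
  set α : ∀ D : Finset V, (∀ u : D, I u) → ℝ :=
    fun D k => κ⁻¹ * ∫ ω, marginal (p ω) D k ∂μ with hα
  have hpos : ∀ D k, 0 < α D k :=
    fun D k => mul_pos (inv_pos.2 hκ) (hp₁.integral_marginal_pos D k)
  refine ⟨hp, K, C, hC, α, ⟨fun l k => hpos _ _, fun l m h s => ?_⟩, fun r => ?_⟩
  · simp only [hα]
    rw [← Finset.mul_sum, ← integral_finsetSum _ fun k _ => hp₁.integrable_marginal _ k]
    simp only [sum_marginal_restrict₂]
  -- `F D` collects the Gamma quotients of all the cells of `D`. The moment formula at `w`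
  -- contributes `F (insert w (parents)) / F (parents)`.
  · set F : Finset V → ℝ := fun D =>
      ∏ k, Real.Gamma (α D k + ((marginal r D k : ℕ) : ℝ)) / Real.Gamma (α D k) with hF
    have hF0 : ∀ D, F D ≠ 0 := fun D => (Finset.prod_pos fun k _ => div_pos
      (Real.Gamma_pos_of_pos (add_pos_of_pos_of_nonneg (hpos D k) (Nat.cast_nonneg _)))
      (Real.Gamma_pos_of_pos (hpos D k))).ne'
    rw [normConst_div_normConst, hp₁.integral_prod_pow_eq hG hC hassoc ρ (hind ρ hρ).1]
    refine Eq.trans ?_ (hC.prod_div_prod_separator hG ρ F hF0).symm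
    refine Finset.prod_congr rfl fun w _ => ?_
    simp only [hF]
    rw [← Equiv.prod_comp (consCell (notMem_rootedParents_self ρ w)), Fintype.prod_prod_type,
      ← Finset.prod_div_distrib]
    refine Finset.prod_congr rfl fun k _ => ?_
    -- The counts over the values of `w` add up to the count of the parent cell, which matches the
    -- denominator.
    rw [hp₁.moment_condProb_eq hG hκ hVR hER (α := α) (fun _ _ => rfl), ← Nat.cast_sum,
      sum_marginal_consCell]
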